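/- Let $M$ be a complete (connected, second countable, smooth, finite-dimensional, not necessarily compact) Riemannian manifold with Riemannian distance $d$, let $T:M\to M$ be a Lipschitz map, and let $\mu$ be an ergodic $T$-invariant Borel probability measure on $M$. Then $$h_\mu(T)=\underline{h}^{loc}_\mu(T),$$ as elements of $[0,\infty]$. Here $h_\mu(T)=\sup_{\mathcal P}\lim_{n\to\infty}\frac1n H_\mu(\mathcal P^n)$ is the measure-theoretic entropy: the supremum is over all finite measurable partitions $\mathcal P$ of $M$, $\mathcal P^n$ is the partition into all intersections $\bigcap_{i=0}^{n-1}T^{-i}P_i$ with $P_i\in\mathcal P$, and $H_\mu(\mathcal Q)=-\sum_{Q\in\mathcal Q}\mu(Q)\log\mu(Q)$ with $0\log 0=0$. Further, $$\underline{h}^{loc}_\mu(T)=\operatorname*{ess\,inf}_{x\in M}\ \lim_{r\to0}\ \liminf_{n\to\infty}-\frac1n\log\mu(B_n(x,r))$$ is the lower Brin–Katok local entropy, where the essential infimum is with respect to $\mu$, $-\log 0=\infty$, and $B_n(x,r)=\{y\in M: d(T^ix,T^iy)<r\text{ for all }0\le i\le n-1\}$. -/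

import Mathlib

open MeasureTheory Filter Set Bundle
open scoped Topology Manifold ContDiff NNReal ENNReal

noncomputable section

namespace LocEntropy

/-- The family `A` is a measurable partition of `X` (cells are allowed to be empty). -/
structure IsMeasurablePartition {X ι : Type*} [MeasurableSpace X] (A : ι → Set X) : Prop where
  measurableSet : ∀ i, MeasurableSet (A i)
  disjoint : Pairwise fun i j => Disjoint (A i) (A j)
  iUnion_eq : ⋃ i, A i = univ

/-- The entropy `H_μ(A) = - ∑ μ(A i) log μ(A i)` of a finite partition, with `0 log 0 = 0`. -/
def partitionEntropy {X ι : Type*} [MeasurableSpace X] [Fintype ι] (μ : Measure X)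
    (A : ι → Set X) : ℝ :=
  ∑ i, Real.negMulLog (μ.real (A i))

/-- The partition `Aⁿ`: its cells are the intersections
`A (a 0) ∩ T⁻¹ (A (a 1)) ∩ ⋯ ∩ T⁻⁽ⁿ⁻¹⁾ (A (a (n-1)))`. -/
def iteratedPartition {X ι : Type*} (T : X → X) (A : ι → Set X) (n : ℕ) :
    (Fin n → ι) → Set X :=
  fun a => ⋂ i : Fin n, T^[(i : ℕ)] ⁻¹' A (a i)

/-- The entropy `h_μ(T, A) = lim (1/n) H_μ(Aⁿ)` of `T` with respect to the finite partition `A`.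
For a `T`-invariant measure the sequence `H_μ(Aⁿ)` is subadditive, so the limit exists and the
upper limit written here is that limit. -/
def entropyOfPartition {X ι : Type*} [MeasurableSpace X] [Fintype ι] (T : X → X)
    (μ : Measure X) (A : ι → Set X) : EReal :=
  limsup (fun n : ℕ => ((partitionEntropy μ (iteratedPartition T A n) / n : ℝ) : EReal)) atTop

/-- The measure-theoretic entropy `h_μ(T)`: the supremum of `h_μ(T, A)` over all finite
measurable partitions `A`. -/
def measureEntropy {X : Type*} [MeasurableSpace X] (T : X → X) (μ : Measure X) : EReal :=
  ⨆ (k : ℕ) (A : Fin k → Set X) (_ : IsMeasurablePartition A), entropyOfPartition T μ A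

/-- The `(n, r)`-dynamical ball `B_n(x, r)`. -/
def dynBall {X : Type*} [MetricSpace X] (T : X → X) (n : ℕ) (x : X) (r : ℝ) : Set X :=
  {y | ∀ i < n, dist (T^[i] x) (T^[i] y) < r}

/-- `liminf_{n → ∞} - (1/n) log μ(B_n(x, r))`, where `- log 0 = ∞`. -/
def lowerLocalEntropyAtScale {X : Type*} [MetricSpace X] [MeasurableSpace X] (T : X → X)
    (μ : Measure X) (x : X) (r : ℝ) : EReal :=
  liminf (fun n : ℕ => -ENNReal.log (μ (dynBall T n x r)) / (n : EReal)) atTop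

/-- The lower local entropy at a point,
`lim_{r → 0} liminf_{n → ∞} - (1/n) log μ(B_n(x, r))`. The expression is monotone in `r`, so the
limit as `r → 0` is the supremum over `r > 0`; see `tendsto_lowerLocalEntropyAt`. -/
def lowerLocalEntropyAt {X : Type*} [MetricSpace X] [MeasurableSpace X] (T : X → X)
    (μ : Measure X) (x : X) : EReal :=
  ⨆ r : Ioi (0 : ℝ), lowerLocalEntropyAtScale T μ x r

theorem tendsto_lowerLocalEntropyAt {X : Type*} [MetricSpace X] [MeasurableSpace X]
    (T : X → X) (μ : Measure X) (x : X) :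
    Tendsto (lowerLocalEntropyAtScale T μ x) (𝓝[>] 0) (𝓝 (lowerLocalEntropyAt T μ x)) := by
  have h : Antitone (lowerLocalEntropyAtScale T μ x) := by
    intro r s hrs
    refine liminf_le_liminf (Eventually.of_forall fun n => ?_)
    refine EReal.div_le_div_right_of_nonneg (by positivity) ?_
    refine EReal.neg_le_neg_iff.2 (ENNReal.log_monotone (measure_mono ?_))
    exact fun y hy i hi => (hy i hi).trans_le hrs
  have := h.tendsto_nhdsGT (0 : ℝ)
  rwa [sSup_image'] at this

/-- The lower Brin–Katok local entropy of `T` relative to `μ`: the `μ`-essential infimum of the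
lower local entropies at points. -/
def lowerLocalEntropy {X : Type*} [MetricSpace X] [MeasurableSpace X] (T : X → X)
    (μ : Measure X) : EReal :=
  essInf (lowerLocalEntropyAt T μ) μ

end LocEntropy

end

/-! The two inequalities have different inputs, and neither passes through a
Shannon–McMillan–Breiman theorem. The common tool is Gibbs' inequality (`mapEntropy_le_integral`):
any subprobability weight on words bounds the entropy of the distribution of words from above by the
mean of its negative logarithm.

Entropy is at most local entropy (`measureEntropy_le_lowerLocalEntropy`); this uses ergodicity. Let
`b` exceed the lower local entropy. By ergodicity almost every point has infinitely many `n` with a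
dynamical ball of measure at least `exp (-n b)` (`ae_frequently_exp_le_measureReal_dynBall`), and
for each `n` such points are covered by at most `exp (n b)` dynamical balls of doubled radius. The
centre of such a ball predicts the itinerary of every point in it, except at visits to a set of
small measure near the boundaries of the partition. Long itineraries are therefore concatenations of
noisy copies of few code words. `blockWeight` turns this into a subprobability weight with
exponential cost about `b` per letter, and `itineraryEntropy_le_of_blocks` averages the cost.

Local entropy is at most entropy (`lowerLocalEntropy_le_measureEntropy`); this uses the Lipschitz
condition, finite dimension and invariance, in the manner of Mañé. Fix a compact `K` of almost full
measure. A point of `K` with return time `k` is located to precision of order `L ^ (-k)`, which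
controls its orbit until it returns. Hence points of `K` with the same itinerary of cells lie in one
dynamical ball (`itinerary_returnCell_fiber_subset`), and small dynamical balls force large entropy.
Since `K` is covered by polynomially many balls of radius `1 / n`, the number of cells at return
time `k` is exponential in `k`. As return times are summable, in the spirit of Kac's lemma, merging
the cells of late return into one costs little entropy (`mapEntropy_itinerary_le`) and leaves a
finite partition. -/

/-! ### Comparison of Riemannian and chart distance -/

section Chart

open Manifold Metric

attribute [local instance] normedAddCommGroupTangentSpaceVectorSpace
  normedSpaceTangentSpaceVectorSpace

variable {E : Type*} [NormedAddCommGroup E] [NormedSpace ℝ E]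
  {H : Type*} [TopologicalSpace H] {I : ModelWithCorners ℝ E H}
  {M : Type*} [PseudoEMetricSpace M] [ChartedSpace H M]
  [RiemannianBundle (fun x : M => TangentSpace I x)]
  [IsManifold I 1 M] [IsContinuousRiemannianBundle E (fun x : M => TangentSpace I x)]

variable (I) in
/-- On a neighbourhood of any point, the Riemannian distance between two points is controlled by
their distance in the extended chart. -/
theorem eventually_riemannianEDist_le_edist_extChartAt_pair (x : M) :
    ∃ C > (0 : ℝ≥0), ∃ s ∈ 𝓝 x, ∀ y ∈ s, ∀ z ∈ s,
      riemannianEDist I y z ≤ C * edist (extChartAt I x y) (extChartAt I x z) := by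
  obtain ⟨C, C_pos, hC⟩ := eventually_enorm_mfderivWithin_symm_extChartAt_lt I x
  refine ⟨C, C_pos, ?_⟩
  obtain ⟨v, hv, hvC⟩ := hC.exists_mem
  obtain ⟨r, r_pos, hr⟩ : ∃ r > 0,
      ball (extChartAt I x x) r ∩ range I ⊆ (extChartAt I x).target ∩ v :=
    mem_nhdsWithin_iff.1 (inter_mem (extChartAt_target_mem_nhdsWithin x) hv)
  have A : (extChartAt I x) ⁻¹' (ball (extChartAt I x x) r ∩ range I) ∈ 𝓝 x := by
    apply extChartAt_preimage_mem_nhds_of_mem_nhdsWithin (by simp)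
    rw [inter_comm]
    exact inter_mem_nhdsWithin _ (ball_mem_nhds _ r_pos)
  refine ⟨_, inter_mem A (chart_source_mem_nhds H x), ?_⟩
  rintro y ⟨hy, h'y⟩ z ⟨hz, h'z⟩
  -- The competitor path is the chart segment pulled back to `M`. Convexity of the ball and of
  -- `range I` keeps the segment where the derivative of the inverse chart is bounded by `C`.
  let η := ContinuousAffineMap.lineMap (R := ℝ) (extChartAt I x y) (extChartAt I x z)
  set γ := (extChartAt I x).symm ∘ η
  have hη : Icc 0 1 ⊆ ⇑η ⁻¹' ((extChartAt I x).target ∩ v) := by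
    simp only [← image_subset_iff, ContinuousAffineMap.coe_lineMap_eq,
     ← segment_eq_image_lineMap, η]
    apply Subset.trans _ hr
    exact ((convex_ball _ _).inter I.convex_range).segment_subset hy hz
  simp only [preimage_inter, subset_inter_iff] at hη
  have η_smooth : ContMDiffOn 𝓘(ℝ, ℝ) 𝓘(ℝ, E) 1 η (Icc 0 1) := by
    apply ContMDiff.contMDiffOn
    rw [contMDiff_iff_contDiff]
    exact ContinuousAffineMap.contDiff _
  have : riemannianEDist I y z ≤ pathELength I γ 0 1 := by
    apply riemannianEDist_le_pathELength _ _ _ zero_le_one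
    · exact (contMDiffOn_extChartAt_symm x).comp η_smooth hη.1
    · simp [γ, η, ContinuousAffineMap.coe_lineMap_eq, h'y]
    · simp [γ, η, ContinuousAffineMap.coe_lineMap_eq, h'z]
  apply this.trans
  rw [← lintegral_fderiv_lineMap_eq_edist, pathELength_eq_lintegral_mfderivWithin_Icc,
    ← lintegral_const_mul' _ _ ENNReal.coe_ne_top]
  apply setLIntegral_mono' measurableSet_Icc (fun t ht ↦ ?_)
  have : mfderivWithin 𝓘(ℝ, ℝ) I γ (Icc 0 1) t =
      (mfderivWithin 𝓘(ℝ, E) I (extChartAt I x).symm (range I) (η t)) ∘L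
        (mfderivWithin 𝓘(ℝ, ℝ) 𝓘(ℝ, E) η (Icc 0 1) t) := by
    apply mfderivWithin_comp
    · exact mdifferentiableWithinAt_extChartAt_symm (hη.1 ht)
    · exact η_smooth.mdifferentiableOn one_ne_zero t ht
    · exact hη.1.trans (preimage_mono (extChartAt_target_subset_range x))
    · rw [uniqueMDiffWithinAt_iff_uniqueDiffWithinAt]
      exact uniqueDiffOn_Icc zero_lt_one t ht
  have : mfderivWithin 𝓘(ℝ, ℝ) I γ (Icc 0 1) t 1 =
      (mfderivWithin 𝓘(ℝ, E) I (extChartAt I x).symm (range I) (η t))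
        (mfderivWithin 𝓘(ℝ, ℝ) 𝓘(ℝ, E) η (Icc 0 1) t 1) := congr($this 1)
  rw [this]
  apply (ContinuousLinearMap.le_opENorm _ _).trans
  gcongr
  · exact (hvC _ (hη.2 ht)).le
  · simp only [mfderivWithin_eq_fderivWithin]
    exact le_of_eq rfl

end Chart

/-! ### Polynomial covers -/

/-- The set `s` can be covered by polynomially many (in `n`) closed balls of radius `1 / n`. -/
def HasPolynomialCover {X : Type*} [MetricSpace X] (s : Set X) : Prop :=
  ∃ C D : ℕ, ∀ n : ℕ, 0 < n → ∃ F : Finset X, F.card ≤ C * n ^ D ∧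
    s ⊆ ⋃ z ∈ F, Metric.closedBall z (1 / n)

namespace HasPolynomialCover

variable {X : Type*} [MetricSpace X] {s t : Set X}

theorem empty : HasPolynomialCover (∅ : Set X) :=
  ⟨0, 0, fun _ _ => ⟨∅, by simp⟩⟩

theorem mono (hst : s ⊆ t) (ht : HasPolynomialCover t) : HasPolynomialCover s := by
  obtain ⟨C, D, h⟩ := ht
  refine ⟨C, D, fun n hn => ?_⟩
  obtain ⟨F, hF, hF'⟩ := h n hn
  exact ⟨F, hF, hst.trans hF'⟩

theorem union (hs : HasPolynomialCover s) (ht : HasPolynomialCover t) :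
    HasPolynomialCover (s ∪ t) := by
  classical
  obtain ⟨C, D, h⟩ := hs
  obtain ⟨C', D', h'⟩ := ht
  refine ⟨C + C', max D D', fun n hn => ?_⟩
  obtain ⟨F, hF, hF'⟩ := h n hn
  obtain ⟨G, hG, hG'⟩ := h' n hn
  refine ⟨F ∪ G, ?_, ?_⟩
  · have h1 : n ^ D ≤ n ^ max D D' := Nat.pow_le_pow_right hn (le_max_left _ _)
    have h2 : n ^ D' ≤ n ^ max D D' := Nat.pow_le_pow_right hn (le_max_right _ _)
    calc (F ∪ G).card ≤ F.card + G.card := Finset.card_union_le _ _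
      _ ≤ C * n ^ D + C' * n ^ D' := add_le_add hF hG
      _ ≤ C * n ^ max D D' + C' * n ^ max D D' := by gcongr
      _ = _ := by ring
  · rw [Finset.set_biUnion_union]
    exact union_subset_union hF' hG'

/-- A set on which the distance is controlled by the distance of the images under a bounded map
to a Euclidean space has polynomial covers. -/
theorem of_dist_le {d : ℕ} (f : X → EuclideanSpace ℝ (Fin d)) (C : ℝ) (R : ℝ)
    (hR : ∀ x ∈ s, ∀ i, |f x i| ≤ R)
    (hC : ∀ x ∈ s, ∀ y ∈ s, dist x y ≤ C * dist (f x) (f y)) : HasPolynomialCover s := by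
  classical
  obtain ⟨B, hB⟩ : ∃ B : ℕ, |C| * √d ≤ B := exists_nat_ge _
  obtain ⟨Q, hQ⟩ : ∃ Q : ℕ, R ≤ Q := exists_nat_ge _
  refine ⟨(2 * (Q * (B + 1)) + 1) ^ d, d, fun n hn => ?_⟩
  -- Grid of mesh `1 / m`: points in the same cube have images at distance at most `√d / m`, and `B
  -- ≥ |C| * √d` brings this down to `1 / n` in `X`.
  set m : ℕ := (B + 1) * n with hm
  have hm0 : (0 : ℝ) < m := by positivity
  let g : X → Fin d → ℤ := fun x i => ⌊m * f x i⌋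
  let J : Finset (Fin d → ℤ) := Fintype.piFinset fun _ => Finset.Icc (-(Q * m : ℤ)) (Q * m)
  have hgJ : ∀ x ∈ s, g x ∈ J := by
    intro x hx
    refine Fintype.mem_piFinset.2 fun i => Finset.mem_Icc.2 ?_
    have h1 := abs_le.1 ((hR x hx i).trans hQ)
    constructor
    · refine Int.le_floor.2 ?_
      push_cast
      nlinarith
    · refine Int.floor_le_iff.2 ?_
      push_cast
      nlinarith
  have hclose : ∀ x ∈ s, ∀ y ∈ s, g x = g y → dist x y ≤ 1 / n := by
    intro x hx y hy hxy
    have h1 : ∀ i, dist (f x i) (f y i) ≤ 1 / m := by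
      intro i
      have := Int.abs_sub_lt_one_of_floor_eq_floor (congrFun hxy i)
      rw [← mul_sub, abs_mul, abs_of_pos hm0] at this
      rw [Real.dist_eq, le_div_iff₀ hm0]
      linarith
    have h2 : dist (f x) (f y) ≤ √d * (1 / m) := by
      rw [EuclideanSpace.dist_eq]
      calc √(∑ i, dist (f x i) (f y i) ^ 2) ≤ √(∑ _i : Fin d, (1 / (m : ℝ)) ^ 2) := by
            gcongr with i
            exact h1 i
        _ = √d * (1 / m) := by
            rw [Finset.sum_const, Finset.card_univ, Fintype.card_fin, nsmul_eq_mul,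
              Real.sqrt_mul (by positivity), Real.sqrt_sq (by positivity)]
    calc dist x y ≤ C * dist (f x) (f y) := hC x hx y hy
      _ ≤ |C| * (√d * (1 / m)) := by
          gcongr
          exact le_abs_self C
      _ = |C| * √d * (1 / m) := by ring
      _ ≤ (B + 1) * (1 / m) := by gcongr; linarith
      _ = 1 / n := by
          rw [hm]
          push_cast
          field_simp
  -- Centres are chosen in `s`, one for each cube that meets the image of `s`, since the distance
  -- estimate holds only between points of `s`.
  let K : Finset (Fin d → ℤ) := J.filter fun u => ∃ x ∈ s, g x = u
  have hK : ∀ u : K, ∃ x ∈ s, g x = u := fun u => (Finset.mem_filter.1 u.2).2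
  choose c hcs hc using hK
  refine ⟨Finset.univ.image c, ?_, fun x hx => ?_⟩
  · calc (Finset.univ.image c).card ≤ (Finset.univ : Finset K).card := Finset.card_image_le
      _ = K.card := by simp
      _ ≤ J.card := Finset.card_filter_le _ _
      _ = (2 * (Q * m) + 1) ^ d := by
          rw [Fintype.card_piFinset]
          simp only [Int.card_Icc, Finset.prod_const, Finset.card_univ, Fintype.card_fin]
          congr 1
          rw [show ((Q * m : ℤ) + 1 - -(Q * m)) = ((2 * (Q * m) + 1 : ℕ) : ℤ) by push_cast; ring]
          exact Int.toNat_natCast _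
      _ ≤ ((2 * (Q * (B + 1)) + 1) * n) ^ d := by
          refine Nat.pow_le_pow_left ?_ _
          rw [hm]
          nlinarith
      _ = _ := mul_pow _ _ _
  · have hu : g x ∈ K := Finset.mem_filter.2 ⟨hgJ x hx, x, hx, rfl⟩
    refine mem_iUnion₂.2 ⟨c ⟨g x, hu⟩, Finset.mem_image_of_mem _ (Finset.mem_univ _), ?_⟩
    exact hclose x hx _ (hcs _) (hc ⟨g x, hu⟩).symm

end HasPolynomialCover

/-- Compact subsets of a finite-dimensional Riemannian manifold have polynomial covers. -/
theorem IsCompact.hasPolynomialCover {d : ℕ} {M : Type*} [MetricSpace M]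
    [ChartedSpace (EuclideanSpace ℝ (Fin d)) M] [IsManifold (𝓡 d) 1 M]
    [RiemannianBundle (fun x : M => TangentSpace (𝓡 d) x)]
    [IsContinuousRiemannianBundle (EuclideanSpace ℝ (Fin d))
      (fun x : M => TangentSpace (𝓡 d) x)]
    [IsRiemannianManifold (𝓡 d) M] {K : Set M} (hK : IsCompact K) : HasPolynomialCover K := by
  refine hK.induction_on .empty (fun _ _ h => .mono h) (fun _ _ => .union) fun x _ => ?_
  obtain ⟨C, -, s, hs, h⟩ := eventually_riemannianEDist_le_edist_extChartAt_pair (𝓡 d) x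
  have hb : (extChartAt (𝓡 d) x) ⁻¹' Metric.ball (extChartAt (𝓡 d) x x) 1 ∈ 𝓝 x :=
    (continuousAt_extChartAt x).preimage_mem_nhds (Metric.ball_mem_nhds _ one_pos)
  refine ⟨s ∩ (extChartAt (𝓡 d) x) ⁻¹' Metric.ball (extChartAt (𝓡 d) x x) 1,
    mem_nhdsWithin_of_mem_nhds (inter_mem hs hb), ?_⟩
  refine .of_dist_le (extChartAt (𝓡 d) x) C (‖extChartAt (𝓡 d) x x‖ + 1) ?_ ?_
  · rintro y ⟨-, hy⟩ i
    have h1 : ‖extChartAt (𝓡 d) x y‖ ≤ ‖extChartAt (𝓡 d) x x‖ + 1 := by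
      have := norm_le_norm_add_norm_sub' (extChartAt (𝓡 d) x y) (extChartAt (𝓡 d) x x)
      rw [mem_preimage, mem_ball_iff_norm] at hy
      linarith
    exact (PiLp.norm_apply_le _ i).trans h1
  · rintro y ⟨hy, -⟩ z ⟨hz, -⟩
    have := h y hy z hz
    rw [← IsRiemannianManifold.out (I := 𝓡 d) y z, edist_dist, edist_dist,
      ← ENNReal.ofReal_coe_nnreal, ← ENNReal.ofReal_mul C.coe_nonneg] at this
    exact (ENNReal.ofReal_le_ofReal_iff (by positivity)).1 this

/-! ### Entropy of finite-valued maps and Gibbs' inequality -/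

namespace LocEntropy

section Gibbs

variable {α : Type*} [Fintype α]

/-- Gibbs' inequality, for a probability vector `p` and a subprobability vector `w`. -/
theorem sum_negMulLog_le_of_sum_le_one {p w : α → ℝ} (hp : ∀ a, 0 ≤ p a) (hp1 : ∑ a, p a = 1)
    (hw : ∀ a, 0 ≤ w a) (hpw : ∀ a, 0 < p a → 0 < w a) (hw1 : ∑ a, w a ≤ 1) :
    ∑ a, Real.negMulLog (p a) ≤ ∑ a, p a * -Real.log (w a) := by
  have key : ∀ a, Real.negMulLog (p a) ≤ p a * -Real.log (w a) + (w a - p a) := by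
    intro a
    rcases (hp a).eq_or_lt with h | h
    · simp [← h, hw a]
    · have h1 := Real.log_le_sub_one_of_pos (div_pos (hpw a h) h)
      rw [Real.log_div (hpw a h).ne' h.ne'] at h1
      have h2 := mul_le_mul_of_nonneg_left h1 h.le
      have h3 : p a * (w a / p a - 1) = w a - p a := by field_simp
      rw [Real.negMulLog]
      linarith
  calc ∑ a, Real.negMulLog (p a) ≤ ∑ a, (p a * -Real.log (w a) + (w a - p a)) :=
        Finset.sum_le_sum fun a _ => key a
    _ = ∑ a, p a * -Real.log (w a) + (∑ a, w a - ∑ a, p a) := by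
        rw [Finset.sum_add_distrib, Finset.sum_sub_distrib]
    _ ≤ _ := by linarith

end Gibbs

variable {X : Type*} [MeasurableSpace X]

/-- The entropy of the partition of `X` into the fibres of a map to a finite type. -/
noncomputable def mapEntropy {α : Type*} [Fintype α] (μ : Measure X) (P : X → α) : ℝ :=
  ∑ a, Real.negMulLog (μ.real (P ⁻¹' {a}))

/-- The word formed by the symbols `f x, f (T x), …, f (T^(n-1) x)`. -/
def itinerary {α : Type*} (T : X → X) (f : X → α) (n : ℕ) (x : X) : Fin n → α :=
  fun i => f (T^[i] x)

/-- The entropy of `T` relative to the partition into the fibres of a map to a finite type. -/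
noncomputable def itineraryEntropy {α : Type*} [Fintype α] (T : X → X) (μ : Measure X) (f : X → α) : EReal :=
  limsup (fun n : ℕ => ((mapEntropy μ (itinerary T f n) / n : ℝ) : EReal)) atTop

theorem mapEntropy_nonneg {α : Type*} [Fintype α] (μ : Measure X) [IsProbabilityMeasure μ]
    (P : X → α) : 0 ≤ mapEntropy μ P :=
  Finset.sum_nonneg fun _ _ => Real.negMulLog_nonneg measureReal_nonneg measureReal_le_one

/-- If the fibres through the points of `E` have measure at most `exp (-s)`, then the entropy is
at least `s * μ E`. -/
theorem mul_measureReal_le_mapEntropy {α : Type*} [Fintype α] {μ : Measure X}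
    [IsProbabilityMeasure μ] (P : X → α) {E : Set X} {s : ℝ} (hs : 0 ≤ s)
    (hE : ∀ x ∈ E, μ.real (P ⁻¹' {P x}) ≤ Real.exp (-s)) :
    s * μ.real E ≤ mapEntropy μ P := by
  classical
  let F : Finset α := Finset.univ.filter fun a => ∃ x ∈ E, P x = a
  have h1 : ∀ a ∈ F, s * μ.real (P ⁻¹' {a}) ≤ Real.negMulLog (μ.real (P ⁻¹' {a})) := by
    intro a ha
    obtain ⟨x, hx, rfl⟩ := (Finset.mem_filter.1 ha).2
    have h2 := hE x hx
    rcases (measureReal_nonneg (μ := μ) (s := P ⁻¹' {P x})).eq_or_lt with h | h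
    · simp [← h]
    · have h3 : Real.log (μ.real (P ⁻¹' {P x})) ≤ -s := (Real.log_le_iff_le_exp h).2 h2
      rw [Real.negMulLog]
      nlinarith
  calc s * μ.real E ≤ s * μ.real (⋃ a ∈ F, P ⁻¹' {a}) := by
        gcongr
        · exact measure_ne_top _ _
        · intro x hx
          exact mem_iUnion₂.2 ⟨P x, Finset.mem_filter.2 ⟨Finset.mem_univ _, x, hx, rfl⟩, rfl⟩
    _ ≤ s * ∑ a ∈ F, μ.real (P ⁻¹' {a}) := by
        gcongr
        exact measureReal_biUnion_finset_le _ _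
    _ = ∑ a ∈ F, s * μ.real (P ⁻¹' {a}) := Finset.mul_sum _ _ _
    _ ≤ ∑ a ∈ F, Real.negMulLog (μ.real (P ⁻¹' {a})) := Finset.sum_le_sum h1
    _ ≤ mapEntropy μ P := Finset.sum_le_univ_sum_of_nonneg fun a =>
        Real.negMulLog_nonneg measureReal_nonneg measureReal_le_one

section Map

variable {α : Type*} [Fintype α] [MeasurableSpace α] [MeasurableSingletonClass α]
  {μ : Measure X} [IsProbabilityMeasure μ] {P : X → α}

theorem integrable_comp_of_fintype (hP : Measurable P) (g : α → ℝ) :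
    Integrable (fun x => g (P x)) μ :=
  (Integrable.of_finite (μ := μ.map P) (f := g)).comp_measurable hP

theorem integral_comp_of_fintype (hP : Measurable P) (g : α → ℝ) :
    ∫ x, g (P x) ∂μ = ∑ a, μ.real (P ⁻¹' {a}) * g a := by
  have : IsProbabilityMeasure (μ.map P) := Measure.isProbabilityMeasure_map hP.aemeasurable
  rw [← integral_map hP.aemeasurable (measurable_of_finite g).aestronglyMeasurable,
    integral_fintype .of_finite]
  refine Finset.sum_congr rfl fun a _ => ?_
  rw [map_measureReal_apply hP (measurableSet_singleton a), smul_eq_mul]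

theorem sum_measureReal_fiber (hP : Measurable P) : ∑ a, μ.real (P ⁻¹' {a}) = 1 := by
  simpa using (integral_comp_of_fintype (μ := μ) hP fun _ => 1).symm

/-- Gibbs' inequality in the form used for both halves: `w` is a guess for the distribution of `P`,
and a guess never has a smaller mean code length than the entropy. -/
theorem mapEntropy_le_integral (hP : Measurable P) {w : α → ℝ} (hw : ∀ a, 0 ≤ w a)
    (hpw : ∀ a, 0 < μ.real (P ⁻¹' {a}) → 0 < w a) (hw1 : ∑ a, w a ≤ 1) :
    mapEntropy μ P ≤ ∫ x, -Real.log (w (P x)) ∂μ := by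
  rw [integral_comp_of_fintype hP fun a => -Real.log (w a)]
  exact sum_negMulLog_le_of_sum_le_one (fun _ => measureReal_nonneg) (sum_measureReal_fiber hP)
    hw hpw hw1

theorem mapEntropy_eq_integral (hP : Measurable P) :
    mapEntropy μ P = ∫ x, -Real.log (μ.real (P ⁻¹' {P x})) ∂μ := by
  rw [integral_comp_of_fintype hP fun a => -Real.log (μ.real (P ⁻¹' {a}))]
  simp [mapEntropy, Real.negMulLog]

end Map

theorem mapEntropy_equiv_comp {α β : Type*} [Fintype α] [Fintype β] (μ : Measure X) (e : α ≃ β)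
    (P : X → α) : mapEntropy μ (fun x => e (P x)) = mapEntropy μ P := by
  refine (Fintype.sum_equiv e _ _ fun a => ?_).symm
  congr 3
  ext x
  simp

theorem measurable_itinerary {α : Type*} [MeasurableSpace α] {T : X → X} (hT : Measurable T)
    {f : X → α} (hf : Measurable f) (n : ℕ) : Measurable (itinerary T f n) :=
  measurable_pi_lambda _ fun i => hf.comp (hT.iterate i)

theorem iteratedPartition_fiber {X α : Type*} (T : X → X) (f : X → α) (n : ℕ) (u : Fin n → α) :
    iteratedPartition T (fun a => f ⁻¹' {a}) n u = itinerary T f n ⁻¹' {u} := by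
  ext x
  simp [iteratedPartition, itinerary, funext_iff]

theorem entropyOfPartition_fiber {α : Type*} [Fintype α] (T : X → X) (μ : Measure X)
    (f : X → α) : entropyOfPartition T μ (fun a => f ⁻¹' {a}) = itineraryEntropy T μ f := by
  simp only [entropyOfPartition, itineraryEntropy, partitionEntropy, mapEntropy,
    iteratedPartition_fiber]

theorem isMeasurablePartition_fiber {α : Type*} [MeasurableSpace α] [MeasurableSingletonClass α]
    {f : X → α} (hf : Measurable f) : IsMeasurablePartition fun a => f ⁻¹' {a} where
  measurableSet a := hf (measurableSet_singleton a)
  disjoint a b hab := Disjoint.preimage _ (by simpa using hab)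
  iUnion_eq := by
    ext x
    simp

theorem IsMeasurablePartition.exists_fiber {ι : Type*} [Countable ι] [MeasurableSpace ι]
    {A : ι → Set X} (hA : IsMeasurablePartition A) :
    ∃ f : X → ι, Measurable f ∧ A = fun i => f ⁻¹' {i} := by
  have h : ∀ x, ∃ i, x ∈ A i := fun x => mem_iUnion.1 (hA.iUnion_eq ▸ mem_univ x)
  choose f hf using h
  have hfA : ∀ i, A i = f ⁻¹' {i} := by
    intro i
    ext x
    refine ⟨fun hx => ?_, fun hx => hx ▸ hf x⟩
    by_contra hne
    exact (hA.disjoint hne).notMem_of_mem_left (hf x) hx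
  refine ⟨f, fun s _ => ?_, funext hfA⟩
  rw [← biUnion_preimage_singleton]
  exact .biUnion (to_countable s) fun i _ => hfA i ▸ hA.measurableSet i

theorem itineraryEntropy_le_measureEntropy {α : Type*} [Fintype α] [MeasurableSpace α]
    [MeasurableSingletonClass α] (T : X → X) (μ : Measure X) {f : X → α} (hf : Measurable f) :
    itineraryEntropy T μ f ≤ measureEntropy T μ := by
  let e := Fintype.equivFin α
  have hef : Measurable fun x => e (f x) := (measurable_of_finite e).comp hf
  have h : itineraryEntropy T μ f = itineraryEntropy T μ fun x => e (f x) := by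
    unfold itineraryEntropy
    congr 1
    ext1 n
    rw [← mapEntropy_equiv_comp μ (Equiv.arrowCongr (.refl (Fin n)) e) (itinerary T f n)]
    rfl
  rw [h, ← entropyOfPartition_fiber]
  exact le_iSup_of_le _ <| le_iSup_of_le _ <|
    le_iSup_of_le (isMeasurablePartition_fiber hef) le_rfl

theorem measureEntropy_le {T : X → X} {μ : Measure X} {b : EReal}
    (h : ∀ (k : ℕ) (f : X → Fin k), Measurable f → itineraryEntropy T μ f ≤ b) :
    measureEntropy T μ ≤ b := by
  refine iSup_le fun k => iSup_le fun A => iSup_le fun hA => ?_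
  obtain ⟨f, hf, rfl⟩ := hA.exists_fiber
  rw [entropyOfPartition_fiber]
  exact h k f hf

theorem measureEntropy_nonneg (T : X → X) (μ : Measure X) [IsProbabilityMeasure μ] :
    0 ≤ measureEntropy T μ := by
  refine le_trans ?_ (itineraryEntropy_le_measureEntropy T μ (f := fun _ => ()) measurable_const)
  refine le_limsup_of_frequently_le (Frequently.of_forall fun n => ?_)
  exact EReal.coe_nonneg.2 (div_nonneg (mapEntropy_nonneg μ _) n.cast_nonneg)

/-! ### Sums over words -/

section Words

variable {ι : Type*}

/-- Prepend a symbol to a sequence. -/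
def consSeq (a : ι) (v : ℕ → ι) : ℕ → ι
  | 0 => a
  | j + 1 => v j

/-- Extend a finite word to a sequence. -/
def extendWord [Inhabited ι] {m : ℕ} (u : Fin m → ι) : ℕ → ι :=
  fun j => if h : j < m then u ⟨j, h⟩ else default

theorem extendWord_apply [Inhabited ι] {m : ℕ} (u : Fin m → ι) {j : ℕ} (h : j < m) :
    extendWord u j = u ⟨j, h⟩ := dif_pos h

theorem extendWord_cons [Inhabited ι] {m : ℕ} (a : ι) (u : Fin m → ι) :
    extendWord (Fin.cons a u : Fin (m + 1) → ι) = consSeq a (extendWord u) := by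
  ext j
  cases j with
  | zero => simp [extendWord, consSeq]
  | succ j =>
    by_cases h : j < m
    · have h1 : (⟨j + 1, by omega⟩ : Fin (m + 1)) = Fin.succ ⟨j, h⟩ := rfl
      rw [extendWord_apply _ (by omega : j + 1 < m + 1), h1, Fin.cons_succ]
      exact (extendWord_apply u h).symm
    · simp [extendWord, consSeq, h]

variable [Fintype ι] [Inhabited ι]

/-- The sum of a function over all words of length `m`, each extended to a sequence. -/
def wordSum (m : ℕ) (F : (ℕ → ι) → ℝ) : ℝ :=
  ∑ u : Fin m → ι, F (extendWord u)

theorem wordSum_zero (F : (ℕ → ι) → ℝ) : wordSum 0 F = F fun _ => default := by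
  rw [wordSum, Fintype.sum_unique]
  rfl

theorem wordSum_succ (m : ℕ) (F : (ℕ → ι) → ℝ) :
    wordSum (m + 1) F = ∑ a, wordSum m fun v => F (consSeq a v) := by
  simp only [wordSum]
  rw [← (Fin.consEquiv fun _ : Fin (m + 1) => ι).sum_comp, Fintype.sum_prod_type]
  refine Finset.sum_congr rfl fun a _ => Finset.sum_congr rfl fun u _ => ?_
  rw [← extendWord_cons]
  rfl

/-- The first `n` letters and the remaining `m` are summed independently, so the sum factors. This
is what lets the recursion for `blockWeight` be summed one block at a time. -/
theorem wordSum_prod_mul (n m : ℕ) (g : ℕ → ι → ℝ) (F : (ℕ → ι) → ℝ) :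
    wordSum (n + m) (fun v => (∏ j ∈ Finset.range n, g j (v j)) * F fun j => v (j + n)) =
      (∏ j ∈ Finset.range n, ∑ a, g j a) * wordSum m F := by
  induction n generalizing g with
  | zero => simp
  | succ n ih =>
    rw [show n + 1 + m = (n + m) + 1 by ring, wordSum_succ, Finset.prod_range_succ']
    have : ∀ a, (wordSum (n + m) fun v =>
        (∏ j ∈ Finset.range (n + 1), g j (consSeq a v j)) * F fun j => consSeq a v (j + (n + 1)))
        = g 0 a * ((∏ j ∈ Finset.range n, ∑ a, g (j + 1) a) * wordSum m F) := by
      intro a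
      rw [← ih fun j => g (j + 1)]
      simp only [wordSum]
      rw [Finset.mul_sum]
      refine Finset.sum_congr rfl fun u _ => ?_
      have h1 : (fun j => consSeq a (extendWord u) (j + (n + 1))) =
        fun j => extendWord u (j + n) := rfl
      rw [Finset.prod_range_succ', h1]
      simp only [consSeq]
      ring
    simp_rw [this]
    rw [← Finset.sum_mul]
    ring

end Words

/-! ### The block code as a subprobability weight -/

section BlockWeight

variable {ι : Type*} [Fintype ι] [DecidableEq ι] {β : Type*}

/-- The transition probabilities of a noisy channel: a symbol is transmitted correctly with
probability `1 - ε`. -/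
noncomputable def channel (ε : ℝ) (c a : ι) : ℝ :=
  if c = a then 1 - ε else ε / Fintype.card ι

/-- The weight of a word of length `m` that is produced as a concatenation of single uniformly
distributed symbols and of noisy copies of the code words `code b`, `b ∈ B`, of length `len b`,
which are chosen with probability `q b`. -/
noncomputable def blockWeight (B : Finset β) (len : β → ℕ) (code : β → ℕ → ι) (q : β → ℝ)
    (ε : ℝ) : ℕ → (ℕ → ι) → ℝ
  | 0, _ => 1
  | m + 1, v =>
    1 / (2 * Fintype.card ι) * blockWeight B len code q ε m (fun j => v (j + 1)) +
      ∑ b ∈ B, if 0 < len b ∧ len b ≤ m + 1 then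
        q b * ((∏ j ∈ Finset.range (len b), channel ε (code b j) (v j)) *
          blockWeight B len code q ε (m + 1 - len b) fun j => v (j + len b)) else 0
  termination_by m => m
  decreasing_by all_goals omega

variable {B : Finset β} {len : β → ℕ} {code : β → ℕ → ι} {q : β → ℝ} {ε : ℝ}

theorem channel_nonneg (hε : 0 ≤ ε) (hε1 : ε ≤ 1) (c a : ι) : 0 ≤ channel ε c a := by
  unfold channel
  split_ifs
  · linarith
  · positivity

theorem sum_channel_le_one (hε : 0 ≤ ε) (c : ι) : ∑ a, channel ε c a ≤ 1 := by
  have : Nonempty ι := ⟨c⟩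
  have h : ∀ a, channel ε c a ≤ (if c = a then 1 - ε else 0) + ε / Fintype.card ι := by
    intro a
    unfold channel
    split_ifs
    · have : 0 ≤ ε / Fintype.card ι := by positivity
      linarith
    · simp
  calc ∑ a, channel ε c a ≤ ∑ a, ((if c = a then 1 - ε else 0) + ε / Fintype.card ι) :=
        Finset.sum_le_sum fun a _ => h a
    _ = 1 := by
        rw [Finset.sum_add_distrib, Finset.sum_ite_eq, if_pos (Finset.mem_univ _),
          Finset.sum_const, Finset.card_univ, nsmul_eq_mul]
        field_simp
        ring

/-- The recursion never reads past position `m`, so the default letters added by `extendWord` are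
irrelevant. -/
theorem blockWeight_congr {m : ℕ} {v v' : ℕ → ι} (h : ∀ j < m, v j = v' j) :
    blockWeight B len code q ε m v = blockWeight B len code q ε m v' := by
  induction m using Nat.strong_induction_on generalizing v v' with
  | _ m ih =>
    cases m with
    | zero => simp [blockWeight]
    | succ m =>
      rw [blockWeight, blockWeight, ih m (by omega) fun j hj => h (j + 1) (by omega)]
      congr 1
      refine Finset.sum_congr rfl fun b _ => ?_
      split_ifs with hb
      · rw [ih (m + 1 - len b) (by omega) fun j hj => h (j + len b) (by omega),
          Finset.prod_congr rfl fun j hj => by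
            rw [h j (by have := Finset.mem_range.1 hj; omega)]]
      · rfl

theorem blockWeight_nonneg (hε : 0 ≤ ε) (hε1 : ε ≤ 1) (hq : ∀ b ∈ B, 0 ≤ q b) (m : ℕ)
    (v : ℕ → ι) : 0 ≤ blockWeight B len code q ε m v := by
  induction m using Nat.strong_induction_on generalizing v with
  | _ m ih =>
    cases m with
    | zero => simp [blockWeight]
    | succ m =>
      rw [blockWeight]
      refine add_nonneg (mul_nonneg (by positivity) (ih m (by omega) _))
        (Finset.sum_nonneg fun b hb => ?_)
      split_ifs with h
      · exact mul_nonneg (hq b hb) (mul_nonneg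
          (Finset.prod_nonneg fun j _ => channel_nonneg hε hε1 _ _) (ih _ (by omega) _))
      · exact le_rfl

theorem blockWeight_succ_ge (hε : 0 ≤ ε) (hε1 : ε ≤ 1) (hq : ∀ b ∈ B, 0 ≤ q b) (m : ℕ)
    (v : ℕ → ι) :
    1 / (2 * Fintype.card ι) * blockWeight B len code q ε m (fun j => v (j + 1)) ≤
      blockWeight B len code q ε (m + 1) v := by
  rw [blockWeight]
  refine le_add_of_nonneg_right (Finset.sum_nonneg fun b hb => ?_)
  split_ifs with h
  · exact mul_nonneg (hq b hb) (mul_nonneg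
      (Finset.prod_nonneg fun j _ => channel_nonneg hε hε1 _ _)
      (blockWeight_nonneg hε hε1 hq _ _))
  · exact le_rfl

theorem blockWeight_ge_block (hε : 0 ≤ ε) (hε1 : ε ≤ 1) (hq : ∀ b ∈ B, 0 ≤ q b) {m : ℕ}
    {b : β} (hb : b ∈ B) (hb0 : 0 < len b) (hbm : len b ≤ m) (v : ℕ → ι) :
    q b * ((∏ j ∈ Finset.range (len b), channel ε (code b j) (v j)) *
      blockWeight B len code q ε (m - len b) fun j => v (j + len b)) ≤
      blockWeight B len code q ε m v := by
  obtain ⟨m, rfl⟩ : ∃ m', m = m' + 1 := ⟨m - 1, by omega⟩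
  rw [blockWeight.eq_2]
  have h1 : ∀ b ∈ B, 0 ≤ if 0 < len b ∧ len b ≤ m + 1 then
        q b * ((∏ j ∈ Finset.range (len b), channel ε (code b j) (v j)) *
          blockWeight B len code q ε (m + 1 - len b) fun j => v (j + len b)) else 0 := by
    intro b hb
    split_ifs with h
    · exact mul_nonneg (hq b hb) (mul_nonneg
        (Finset.prod_nonneg fun j _ => channel_nonneg hε hε1 _ _)
        (blockWeight_nonneg hε hε1 hq _ _))
    · exact le_rfl
  have h2 := Finset.single_le_sum h1 hb
  rw [if_pos ⟨hb0, hbm⟩] at h2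
  exact h2.trans (le_add_of_nonneg_left
    (mul_nonneg (by positivity) (blockWeight_nonneg hε hε1 hq _ _)))

/-- Only single letters are used, never a code word. This gives positivity of the weight and handles
the end of a word, where no block may fit. -/
theorem pow_le_blockWeight (hε : 0 ≤ ε) (hε1 : ε ≤ 1) (hq : ∀ b ∈ B, 0 ≤ q b) (m : ℕ)
    (v : ℕ → ι) : (1 / (2 * Fintype.card ι) : ℝ) ^ m ≤ blockWeight B len code q ε m v := by
  induction m generalizing v with
  | zero => simp [blockWeight]
  | succ m ih =>
    rw [pow_succ']
    exact (mul_le_mul_of_nonneg_left (ih _) (by positivity)).trans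
      (blockWeight_succ_ge hε hε1 hq m v)

/-- The first piece of a word is a single letter with total mass `1 / 2`, or a code word with total
mass `∑ q ≤ 1 / 2`; the noise adds no mass, and what follows has mass at most one by induction. -/
theorem wordSum_blockWeight_le_one [Inhabited ι] (hε : 0 ≤ ε) (hε1 : ε ≤ 1)
    (hq : ∀ b ∈ B, 0 ≤ q b) (hq1 : ∑ b ∈ B, q b ≤ 1 / 2) (m : ℕ) :
    wordSum m (blockWeight B len code q ε m) ≤ 1 := by
  induction m using Nat.strong_induction_on with
  | _ m ih =>
    cases m with
    | zero => simp [wordSum_zero, blockWeight]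
    | succ m =>
      have hsum : wordSum (m + 1) (blockWeight B len code q ε (m + 1)) =
          wordSum (m + 1) (fun v => 1 / (2 * Fintype.card ι) *
            blockWeight B len code q ε m fun j => v (j + 1)) +
          ∑ b ∈ B, wordSum (m + 1) fun v => if 0 < len b ∧ len b ≤ m + 1 then
            q b * ((∏ j ∈ Finset.range (len b), channel ε (code b j) (v j)) *
              blockWeight B len code q ε (m + 1 - len b) fun j => v (j + len b)) else 0 := by
        simp only [wordSum]
        rw [Finset.sum_comm, ← Finset.sum_add_distrib]
        exact Finset.sum_congr rfl fun u _ => by rw [blockWeight]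
      have hsingle : wordSum (m + 1) (fun v => 1 / (2 * Fintype.card ι) *
          blockWeight B len code q ε m fun j => v (j + 1)) ≤ 1 / 2 := by
        have hc : ∀ a : ι, (wordSum m fun v => 1 / (2 * Fintype.card ι) *
            blockWeight B len code q ε m fun j => consSeq a v (j + 1)) =
            1 / (2 * Fintype.card ι) * wordSum m (blockWeight B len code q ε m) := by
          intro a
          simp only [wordSum, Finset.mul_sum]
          rfl
        rw [wordSum_succ]
        simp_rw [hc]
        rw [Finset.sum_const, Finset.card_univ, nsmul_eq_mul]
        have h1 := ih m (by omega)
        have h2 : (0 : ℝ) < Fintype.card ι := by positivity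
        calc (Fintype.card ι : ℝ) * (1 / (2 * Fintype.card ι) *
              wordSum m (blockWeight B len code q ε m))
            = 1 / 2 * wordSum m (blockWeight B len code q ε m) := by field_simp
          _ ≤ 1 / 2 := by linarith
      have hblock : ∀ b ∈ B, (wordSum (m + 1) fun v => if 0 < len b ∧ len b ≤ m + 1 then
            q b * ((∏ j ∈ Finset.range (len b), channel ε (code b j) (v j)) *
              blockWeight B len code q ε (m + 1 - len b) fun j => v (j + len b)) else 0) ≤ q b := by
        intro b hb
        by_cases h : 0 < len b ∧ len b ≤ m + 1
        · simp only [h, if_true, and_self]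
          obtain ⟨l, hl⟩ : ∃ l, m + 1 = len b + l := ⟨m + 1 - len b, by omega⟩
          have h1 := wordSum_prod_mul (len b) l (fun j => channel ε (code b j))
            (blockWeight B len code q ε l)
          have h2 : wordSum (len b + l) (fun v => q b *
              ((∏ j ∈ Finset.range (len b), channel ε (code b j) (v j)) *
                blockWeight B len code q ε l fun j => v (j + len b))) =
              q b * ((∏ j ∈ Finset.range (len b), ∑ a, channel ε (code b j) a) *
                wordSum l (blockWeight B len code q ε l)) := by
            rw [← h1]
            simp only [wordSum, Finset.mul_sum]
          rw [hl, show len b + l - len b = l by omega, h2]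
          refine mul_le_of_le_one_right (hq b hb) ?_
          have h3 : 0 ≤ wordSum l (blockWeight B len code q ε l) :=
            Finset.sum_nonneg fun u _ => blockWeight_nonneg hε hε1 hq _ _
          exact mul_le_one₀ (Finset.prod_le_one
            (fun j _ => Finset.sum_nonneg fun a _ => channel_nonneg hε hε1 _ _)
            fun j _ => sum_channel_le_one hε _) h3 (ih l (by omega))
        · simp only [h, if_false]
          simpa [wordSum] using hq b hb
      calc wordSum (m + 1) (blockWeight B len code q ε (m + 1)) ≤ 1 / 2 + ∑ b ∈ B, q b := by
            rw [hsum]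
            exact add_le_add hsingle (Finset.sum_le_sum hblock)
        _ ≤ 1 := by linarith

end BlockWeight

/-! ### Weight of an orbit and the resulting entropy bound -/

section Orbit

variable {X ι β : Type*} [Fintype ι] [DecidableEq ι] {B : Finset β} {len : β → ℕ}
  {code : β → ℕ → ι} {q : β → ℝ} {ε : ℝ}

/-- Lower bound for the weight of the itinerary of a point, provided that from every point that
is not bad, the itinerary is close to a code word. -/
theorem exp_neg_le_blockWeight {T : X → X} {f : X → ι} {bad : Set X} {h γ C : ℝ} {N : ℕ}
    (hh : 0 ≤ h) (hγ : 0 ≤ γ) (hC : 0 ≤ C) (hε : 0 ≤ ε) (hεγ : 1 - ε = Real.exp (-γ))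
    (hC1 : Real.exp (-C) ≤ 1 / (2 * Fintype.card ι)) (hC2 : Real.exp (-C) ≤ ε / Fintype.card ι)
    (hq : ∀ b ∈ B, 0 ≤ q b)
    (hgood : ∀ x ∉ bad, ∃ b ∈ B, 0 < len b ∧ len b ≤ N ∧ Real.exp (-(len b * h)) ≤ q b ∧
      ∀ j < len b, T^[j] x ∉ bad → code b j = f (T^[j] x)) (m : ℕ) (x : X) :
    Real.exp (-(m * (h + γ) + C * ∑ j ∈ Finset.range m, bad.indicator 1 (T^[j] x) + C * N)) ≤
      blockWeight B len code q ε m fun j => f (T^[j] x) := by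
  have hε1 : ε ≤ 1 := by linarith [Real.exp_pos (-γ)]
  have hind : ∀ y, 0 ≤ bad.indicator (1 : X → ℝ) y := fun y =>
    indicator_nonneg (fun _ _ => zero_le_one) y
  have hchannel : ∀ (c : ι) (y : X), (y ∉ bad → c = f y) →
      Real.exp (-(γ + C * bad.indicator 1 y)) ≤ channel ε c (f y) := by
    intro c y hy
    by_cases hyb : y ∈ bad
    · rw [indicator_of_mem hyb, Pi.one_apply, mul_one]
      unfold channel
      split_ifs
      · rw [hεγ, Real.exp_le_exp]
        linarith
      · refine le_trans ?_ hC2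
        rw [Real.exp_le_exp]
        linarith
    · rw [channel, if_pos (hy hyb), hεγ, indicator_of_notMem hyb]
      simp
  induction m using Nat.strong_induction_on generalizing x with
  | _ m ih =>
    -- Fewer than `N` letters are left: they are all spelled out singly at price `C` each, which the
    -- constant term `C * N` pays for.
    rcases lt_or_ge m N with hmN | hmN
    · refine le_trans ?_ (pow_le_blockWeight hε hε1 hq m _)
      refine le_trans ?_ (pow_le_pow_left₀ (Real.exp_pos _).le hC1 m)
      rw [← Real.exp_nat_mul, Real.exp_le_exp]
      have h1 : (m : ℝ) ≤ N := by exact_mod_cast hmN.le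
      have h2 : 0 ≤ C * ∑ j ∈ Finset.range m, bad.indicator 1 (T^[j] x) :=
        mul_nonneg hC (Finset.sum_nonneg fun j _ => hind _)
      have h3 : 0 ≤ m * (h + γ) := by positivity
      nlinarith
    -- At a bad point one letter is spelled out, paid for by the indicator at time zero. At any
    -- other point a whole code word is used; bad times inside it count as transmission errors,
    -- again at price `C` each.
    by_cases hx : x ∈ bad
    · cases m with
      | zero =>
        simp only [blockWeight, Real.exp_le_one_iff]
        simp
        positivity
      | succ m =>
        refine le_trans ?_ (blockWeight_succ_ge hε hε1 hq m _)
        refine le_trans ?_ (mul_le_mul hC1 (ih m (by omega) (T x)) (Real.exp_pos _).le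
          (by positivity))
        rw [← Real.exp_add, Real.exp_le_exp, Finset.sum_range_succ']
        simp only [Function.iterate_succ_apply, Function.iterate_zero_apply, indicator_of_mem hx,
          Pi.one_apply]
        push_cast
        linarith
    · obtain ⟨b, hb, hb0, hbN, hbq, hcode⟩ := hgood x hx
      refine le_trans ?_ (blockWeight_ge_block hε hε1 hq hb hb0 (hbN.trans hmN) _)
      have h1 : Real.exp (-(len b * γ + C * ∑ j ∈ Finset.range (len b),
          bad.indicator 1 (T^[j] x))) ≤
          ∏ j ∈ Finset.range (len b), channel ε (code b j) (f (T^[j] x)) := by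
        calc _ = ∏ j ∈ Finset.range (len b), Real.exp (-(γ + C * bad.indicator 1 (T^[j] x))) := by
              rw [← Real.exp_sum, Finset.sum_neg_distrib, Finset.sum_add_distrib,
                Finset.sum_const, Finset.card_range, nsmul_eq_mul, Finset.mul_sum]
          _ ≤ _ := Finset.prod_le_prod (fun _ _ => (Real.exp_pos _).le) fun j hj =>
              hchannel _ _ (hcode j (Finset.mem_range.1 hj))
      have h2 := ih (m - len b) (by omega) (T^[len b] x)
      simp only [← Function.iterate_add_apply] at h2
      have h3 := mul_le_mul hbq (mul_le_mul h1 h2 (Real.exp_pos _).le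
        (Finset.prod_nonneg fun j _ => channel_nonneg hε hε1 _ _)) (by positivity) (hq b hb)
      refine le_trans (le_of_eq ?_) h3
      rw [← Real.exp_add, ← Real.exp_add]
      congr 1
      have h4 : ∑ j ∈ Finset.range m, bad.indicator (1 : X → ℝ) (T^[j] x) =
          ∑ j ∈ Finset.range (len b), bad.indicator 1 (T^[j] x) +
          ∑ j ∈ Finset.range (m - len b), bad.indicator 1 (T^[j + len b] x) := by
        obtain ⟨l, rfl⟩ : ∃ l, m = len b + l := ⟨m - len b, by omega⟩
        rw [Finset.sum_range_add, show len b + l - len b = l by omega]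
        simp only [add_comm]
      rw [h4, Nat.cast_sub (hbN.trans hmN)]
      ring

variable [MeasurableSpace X] [MeasurableSpace ι] [MeasurableSingletonClass ι]

/-- Gibbs' inequality is applied to the block weight. By invariance the mean number of bad visits in
`m` steps is `m * μ.real bad`, and the end cost `C * N` vanishes after division by `m`. -/
theorem itineraryEntropy_le_of_blocks {μ : Measure X} [IsProbabilityMeasure μ] {T : X → X}
    (hT : MeasurePreserving T μ μ) {f : X → ι} (hf : Measurable f) {bad : Set X}
    (hbad : MeasurableSet bad) {h γ C : ℝ} {N : ℕ}
    (hh : 0 ≤ h) (hγ : 0 ≤ γ) (hC : 0 ≤ C) (hε : 0 ≤ ε) (hεγ : 1 - ε = Real.exp (-γ))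
    (hC1 : Real.exp (-C) ≤ 1 / (2 * Fintype.card ι)) (hC2 : Real.exp (-C) ≤ ε / Fintype.card ι)
    (hq : ∀ b ∈ B, 0 ≤ q b) (hq1 : ∑ b ∈ B, q b ≤ 1 / 2)
    (hgood : ∀ x ∉ bad, ∃ b ∈ B, 0 < len b ∧ len b ≤ N ∧ Real.exp (-(len b * h)) ≤ q b ∧
      ∀ j < len b, T^[j] x ∉ bad → code b j = f (T^[j] x)) :
    itineraryEntropy T μ f ≤ ((h + γ + C * μ.real bad : ℝ) : EReal) := by
  have : Nonempty X := nonempty_of_isProbabilityMeasure μ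
  inhabit X
  have : Inhabited ι := ⟨f default⟩
  have hε1 : ε ≤ 1 := by linarith [Real.exp_pos (-γ)]
  have hint : ∀ j, Integrable (fun x => bad.indicator (1 : X → ℝ) (T^[j] x)) μ := fun j =>
    (hT.iterate j).integrable_comp_of_integrable
      ((integrable_const 1).indicator hbad)
  have hintv : ∀ j, ∫ x, bad.indicator (1 : X → ℝ) (T^[j] x) ∂μ = μ.real bad := by
    intro j
    rw [← integral_indicator_one hbad, ← (hT.iterate j).map_eq,
      integral_map (hT.iterate j).aemeasurable
        (measurable_one.indicator hbad).aestronglyMeasurable, (hT.iterate j).map_eq]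
  have key : ∀ m : ℕ, mapEntropy μ (itinerary T f m) ≤
      m * (h + γ + C * μ.real bad) + C * N := by
    intro m
    have hpos : ∀ v, 0 < blockWeight B len code q ε m v := fun v =>
      lt_of_lt_of_le (by positivity) (pow_le_blockWeight hε hε1 hq m v)
    have hm := measurable_itinerary hT.measurable hf m
    calc mapEntropy μ (itinerary T f m)
        ≤ ∫ x, -Real.log (blockWeight B len code q ε m (extendWord (itinerary T f m x))) ∂μ :=
          mapEntropy_le_integral hm
            (w := fun u => blockWeight B len code q ε m (extendWord u))
            (fun u => (hpos _).le) (fun u _ => hpos _)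
            (wordSum_blockWeight_le_one hε hε1 hq hq1 m)
      _ ≤ ∫ x, (m * (h + γ) + C * ∑ j ∈ Finset.range m, bad.indicator 1 (T^[j] x) + C * N) ∂μ := by
          refine integral_mono (integrable_comp_of_fintype hm fun u =>
            -Real.log (blockWeight B len code q ε m (extendWord u))) ?_ fun x => ?_
          · exact ((integrable_const _).add
              ((integrable_finsetSum _ fun j _ => hint j).const_mul C)).add (integrable_const _)
          · have h1 : blockWeight B len code q ε m (extendWord (itinerary T f m x)) =
                blockWeight B len code q ε m fun j => f (T^[j] x) :=
              blockWeight_congr fun j hj => extendWord_apply _ hj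
            have h2 := exp_neg_le_blockWeight hh hγ hC hε hεγ hC1 hC2 hq hgood m x
            rw [← Real.le_log_iff_exp_le (hpos _)] at h2
            simp only [h1]
            linarith
      _ = _ := by
          rw [integral_add, integral_add, integral_const_mul, integral_const_mul, integral_finsetSum]
          · simp only [hintv]
            simp
            ring
          · exact fun j _ => hint j
          · exact integrable_const _
          · exact (integrable_finsetSum _ fun j _ => hint j).const_mul C
          · exact (integrable_const _).add
              ((integrable_finsetSum _ fun j _ => hint j).const_mul C)
          · exact integrable_const _
  have hlim : Tendsto (fun m : ℕ => ((h + γ + C * μ.real bad + C * N / m : ℝ) : EReal)) atTop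
      (𝓝 ((h + γ + C * μ.real bad : ℝ) : EReal)) := by
    refine (continuous_coe_real_ereal.tendsto _).comp ?_
    simpa using tendsto_const_nhds.add (tendsto_const_div_atTop_nhds_zero_nat (C * N))
  rw [← hlim.limsup_eq]
  refine limsup_le_limsup ?_
  filter_upwards [eventually_gt_atTop 0] with m hm
  have hm' : (0 : ℝ) < m := by exact_mod_cast hm
  refine EReal.coe_le_coe_iff.2 ?_
  rw [div_le_iff₀ hm', add_mul, div_mul_cancel₀ _ hm'.ne', mul_comm _ (m : ℝ)]
  exact key m

end Orbit

/-! ### Dynamical balls and local entropy -/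

theorem neg_log_div_lt_iff {n : ℕ} (hn : 0 < n) {b : ℝ} {m : ℝ≥0∞} (hm : m ≠ ⊤) :
    -ENNReal.log m / (n : EReal) < b ↔ Real.exp (-(n * b)) < m.toReal := by
  have hn' : (0 : ℝ) < n := by exact_mod_cast hn
  rcases eq_or_ne m 0 with rfl | h0
  · have : (⊤ : EReal) / (n : EReal) = ⊤ :=
      EReal.top_div_of_pos_ne_top (by exact_mod_cast hn) (EReal.natCast_ne_top n)
    simp [this, (Real.exp_pos _).le]
  · have hpos : 0 < m.toReal := ENNReal.toReal_pos h0 hm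
    rw [ENNReal.log_pos_real h0 hm, show (n : EReal) = ((n : ℝ) : EReal) from rfl,
      ← EReal.coe_neg, ← EReal.coe_div, EReal.coe_lt_coe_iff, div_lt_iff₀ hn',
      ← Real.lt_log_iff_exp_lt hpos]
    constructor <;> intro h <;> linarith

theorem lt_neg_log_div_iff {n : ℕ} (hn : 0 < n) {b : ℝ} {m : ℝ≥0∞} (hm : m ≠ ⊤) :
    (b : EReal) < -ENNReal.log m / (n : EReal) ↔ m.toReal < Real.exp (-(n * b)) := by
  have hn' : (0 : ℝ) < n := by exact_mod_cast hn
  rcases eq_or_ne m 0 with rfl | h0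
  · have : (⊤ : EReal) / (n : EReal) = ⊤ :=
      EReal.top_div_of_pos_ne_top (by exact_mod_cast hn) (EReal.natCast_ne_top n)
    simp [this, Real.exp_pos]
  · have hpos : 0 < m.toReal := ENNReal.toReal_pos h0 hm
    rw [ENNReal.log_pos_real h0 hm, show (n : EReal) = ((n : ℝ) : EReal) from rfl,
      ← EReal.coe_neg, ← EReal.coe_div, EReal.coe_lt_coe_iff, lt_div_iff₀ hn',
      ← Real.log_lt_iff_lt_exp hpos]
    constructor <;> intro h <;> linarith

variable {X : Type*} [MetricSpace X]

theorem dynBall_succ_subset_preimage (T : X → X) (n : ℕ) (x : X) (r : ℝ) :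
    dynBall T (n + 1) x r ⊆ T ⁻¹' dynBall T n (T x) r :=
  fun _ hy i hi => hy (i + 1) (by omega)

theorem dynBall_mono (T : X → X) (n : ℕ) (x : X) {r s : ℝ} (h : r ≤ s) :
    dynBall T n x r ⊆ dynBall T n x s :=
  fun _ hy i hi => (hy i hi).trans_le h

variable [MeasurableSpace X]

theorem lowerLocalEntropyAtScale_nonneg (T : X → X) (μ : Measure X) [IsProbabilityMeasure μ]
    (x : X) (r : ℝ) : 0 ≤ lowerLocalEntropyAtScale T μ x r := by
  refine le_liminf_of_le (by isBoundedDefault) (Eventually.of_forall fun n => ?_)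
  refine EReal.div_nonneg ?_ (by positivity)
  simpa using prob_le_one

theorem lowerLocalEntropyAt_nonneg (T : X → X) (μ : Measure X) [IsProbabilityMeasure μ]
    (x : X) : 0 ≤ lowerLocalEntropyAt T μ x :=
  le_iSup_of_le ⟨1, mem_Ioi.2 one_pos⟩ (lowerLocalEntropyAtScale_nonneg T μ x 1)

theorem lowerLocalEntropy_nonneg (T : X → X) (μ : Measure X) [IsProbabilityMeasure μ] :
    0 ≤ lowerLocalEntropy T μ :=
  le_essInf_of_ae_le 0 (Eventually.of_forall fun x => lowerLocalEntropyAt_nonneg T μ x)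

theorem frequently_of_lowerLocalEntropyAtScale_lt {T : X → X} {μ : Measure X} [IsFiniteMeasure μ]
    {x : X} {r b : ℝ} (h : lowerLocalEntropyAtScale T μ x r < b) :
    ∃ᶠ n : ℕ in atTop, Real.exp (-(n * b)) < μ.real (dynBall T n x r) :=
  ((frequently_lt_of_liminf_lt (by isBoundedDefault) h).and_eventually
    (eventually_gt_atTop 0)).mono fun _ hn =>
      (neg_log_div_lt_iff hn.2 (measure_ne_top _ _)).1 hn.1

theorem eventually_of_lt_lowerLocalEntropyAtScale {T : X → X} {μ : Measure X} [IsFiniteMeasure μ]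
    {x : X} {r a : ℝ} (h : a < lowerLocalEntropyAtScale T μ x r) :
    ∀ᶠ n : ℕ in atTop, μ.real (dynBall T n x r) < Real.exp (-(n * a)) := by
  filter_upwards [eventually_lt_of_lt_liminf h, eventually_gt_atTop 0] with n hn hn0
  exact (lt_neg_log_div_iff hn0 (measure_ne_top _ _)).1 hn

variable [BorelSpace X] [SecondCountableTopology X]

theorem measurableSet_dynBall {T : X → X} (hT : Measurable T) (n : ℕ) (x : X) (r : ℝ) :
    MeasurableSet (dynBall T n x r) := by
  simp only [dynBall, ofPred_forall]
  exact .iInter fun i => .iInter fun _ =>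
    measurableSet_lt (measurable_const.dist (hT.iterate i)) measurable_const

theorem measurable_measureReal_dynBall {T : X → X} (hT : Measurable T) (μ : Measure X)
    [IsFiniteMeasure μ] (n : ℕ) (r : ℝ) : Measurable fun x => μ.real (dynBall T n x r) := by
  have hs : MeasurableSet {p : X × X | ∀ i < n, dist (T^[i] p.1) (T^[i] p.2) < r} := by
    simp only [ofPred_forall]
    refine .iInter fun i => .iInter fun _ => measurableSet_lt ?_ measurable_const
    exact ((hT.iterate i).comp measurable_fst).dist ((hT.iterate i).comp measurable_snd)
  exact (measurable_measure_prodMk_left hs).ennreal_toReal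

/-- The points with a dynamical ball of measure at least `t` are covered by at most `1 / t`
dynamical balls of twice the radius. -/
theorem exists_finset_cover_dynBall {T : X → X} (hT : Measurable T) (μ : Measure X)
    [IsProbabilityMeasure μ] (n : ℕ) {r t : ℝ} (hr : 0 < r) (ht : 0 < t) :
    ∃ Z : Finset X, Z.card * t ≤ 1 ∧
      ∀ x, t ≤ μ.real (dynBall T n x r) → ∃ z ∈ Z, x ∈ dynBall T n z (2 * r) := by
  classical
  let Good : Finset X → Prop := fun Z => (∀ z ∈ Z, t ≤ μ.real (dynBall T n z r)) ∧
    (Z : Set X).PairwiseDisjoint fun z => dynBall T n z r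
  have hcard : ∀ Z, Good Z → Z.card * t ≤ 1 := by
    intro Z hZ
    calc Z.card * t = ∑ _z ∈ Z, t := by rw [Finset.sum_const, nsmul_eq_mul]
      _ ≤ ∑ z ∈ Z, μ.real (dynBall T n z r) := Finset.sum_le_sum hZ.1
      _ = μ.real (⋃ z ∈ Z, dynBall T n z r) :=
          (measureReal_biUnion_finset hZ.2 fun z _ => measurableSet_dynBall hT n z r).symm
      _ ≤ 1 := measureReal_le_one
  -- Disjointness bounds the size of admissible families, so one of maximal cardinality exists. A
  -- point outside all its doubled balls could be added to it.
  obtain ⟨J, hJ⟩ := exists_nat_ge (1 / t)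
  have hbound : ∀ Z, Good Z → Z.card ≤ J := by
    intro Z hZ
    have h1 : (Z.card : ℝ) ≤ 1 / t := (le_div_iff₀ ht).2 (hcard Z hZ)
    exact_mod_cast h1.trans hJ
  let P : ℕ → Prop := fun j => ∃ Z, Good Z ∧ Z.card = j
  have hP0 : P 0 := ⟨∅, ⟨by simp, by simp⟩, rfl⟩
  obtain ⟨Z, hZ, hZc⟩ : P (Nat.findGreatest P J) := Nat.findGreatest_spec (Nat.zero_le J) hP0
  refine ⟨Z, hcard Z hZ, fun x hx => ?_⟩
  by_contra! hne
  have hxZ : x ∉ Z := fun h => hne x h fun i _ => by simpa using hr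
  have hnew : Good (insert x Z) := by
    refine ⟨fun z hz => ?_, ?_⟩
    · rcases Finset.mem_insert.1 hz with rfl | hz
      · exact hx
      · exact hZ.1 z hz
    · rw [Finset.coe_insert]
      refine hZ.2.insert fun z hz _ => ?_
      refine Set.disjoint_left.2 fun y hyx hyz => hne z hz fun i hi => ?_
      have h1 := hyx i hi
      have h2 := hyz i hi
      have h3 := dist_triangle_right (T^[i] z) (T^[i] x) (T^[i] y)
      linarith
  have h1 := Nat.le_findGreatest (P := P) (hbound _ hnew) (⟨_, hnew, rfl⟩ : P (insert x Z).card)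
  rw [Finset.card_insert_of_notMem hxZ] at h1
  omega

/-- For every scale, almost every point has infinitely many dynamical balls that are large
compared with the lower local entropy. -/
theorem ae_frequently_exp_le_measureReal_dynBall {T : X → X} {μ : Measure X}
    [IsProbabilityMeasure μ] (hT : Ergodic T μ) {b : ℝ} (hb : lowerLocalEntropy T μ < b) {r : ℝ}
    (hr : 0 < r) :
    ∀ᵐ x ∂μ, ∃ᶠ n : ℕ in atTop, Real.exp (-(n * b)) ≤ μ.real (dynBall T n x r) := by
  obtain ⟨c, hc, hcb⟩ := EReal.lt_iff_exists_real_btwn.1 hb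
  have hcb' : c < b := EReal.coe_lt_coe_iff.1 hcb
  -- The free constant `C` makes `S` forward invariant: passing from `x` to `T x` shortens the ball
  -- by one step, a bounded factor. It is absorbed at the end by the gap `c < b`.
  let S : Set X := {x | ∃ C : ℕ, ∃ᶠ n : ℕ in atTop,
    Real.exp (-(n * c) - C) ≤ μ.real (dynBall T n x r)}
  have hS : MeasurableSet S := by
    have : S = ⋃ C : ℕ, ⋂ N : ℕ, ⋃ n : ℕ, ⋃ _ : N ≤ n,
        {x | Real.exp (-(n * c) - C) ≤ μ.real (dynBall T n x r)} := by
      ext x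
      simp [S, frequently_atTop]
    rw [this]
    exact .iUnion fun C => .iInter fun N => .iUnion fun n => .iUnion fun _ =>
      measurableSet_le measurable_const (measurable_measureReal_dynBall hT.measurable μ n r)
  have hST : S ⊆ T ⁻¹' S := by
    rintro x ⟨C, hC⟩
    obtain ⟨D, hD⟩ := exists_nat_ge ((C : ℝ) + |c|)
    refine ⟨D, frequently_atTop.2 fun N => ?_⟩
    obtain ⟨n, hn, hn'⟩ := frequently_atTop.1 hC (N + 1)
    obtain ⟨n, rfl⟩ : ∃ k, n = k + 1 := ⟨n - 1, by omega⟩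
    refine ⟨n, by omega, ?_⟩
    calc Real.exp (-(n * c) - D) ≤ Real.exp (-((n + 1 : ℕ) * c) - C) := by
          rw [Real.exp_le_exp]
          push_cast
          linarith [le_abs_self c]
      _ ≤ μ.real (dynBall T (n + 1) x r) := hn'
      _ ≤ μ.real (T ⁻¹' dynBall T n (T x) r) :=
          measureReal_mono (dynBall_succ_subset_preimage T n x r)
      _ = μ.real (dynBall T n (T x) r) :=
          hT.toMeasurePreserving.measureReal_preimage
            (measurableSet_dynBall hT.measurable n _ r).nullMeasurableSet
  have hS0 : μ S ≠ 0 := by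
    intro h0
    refine hc.not_ge (le_essInf_of_ae_le _ ?_)
    filter_upwards [measure_eq_zero_iff_ae_notMem.1 h0] with x hx
    by_contra hlt
    refine hx ⟨0, ?_⟩
    have h1 : lowerLocalEntropyAtScale T μ x r < c :=
      (le_iSup (fun r : Ioi (0 : ℝ) => lowerLocalEntropyAtScale T μ x r) ⟨r, hr⟩).trans_lt
        (not_le.1 hlt)
    exact (frequently_of_lowerLocalEntropyAtScale_lt h1).mono fun n hn => by simpa using hn.le
  have hfull : ∀ᵐ x ∂μ, x ∈ S := by
    rcases hT.ae_empty_or_univ_of_ae_le_preimage hS.nullMeasurableSet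
      (LE.le.eventuallyLE hST) with h | h
    · exact absurd (measure_congr h) (by simpa using hS0)
    · filter_upwards [h] with x hx
      exact hx.mpr trivial
  filter_upwards [hfull] with x ⟨C, hC⟩
  have h1 : ∀ᶠ n : ℕ in atTop, (C : ℝ) ≤ n * (b - c) :=
    (tendsto_natCast_atTop_atTop.atTop_mul_const (sub_pos.2 hcb')).eventually_ge_atTop _
  refine (hC.and_eventually h1).mono fun n hn => le_trans ?_ hn.1
  rw [Real.exp_le_exp]
  linarith [hn.2]

/-! ### Entropy is at most local entropy -/

/-- Disjoint compact sets, indexed by a finite type, have disjoint thickenings; in particular the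
index can be read off from any nearby point. -/
theorem exists_decoder {X ι : Type*} [MetricSpace X] [Finite ι] [Nonempty ι] {K : ι → Set X}
    (hK : ∀ i, IsCompact (K i)) (hd : Pairwise fun i j => Disjoint (K i) (K j)) :
    ∃ δ > 0, ∃ g : X → ι, ∀ i, ∀ x ∈ K i, ∀ y, dist y x < δ → g y = i := by
  classical
  have h1 : ∀ᶠ δ in 𝓝[>] (0 : ℝ), ∀ i j, i ≠ j →
      Disjoint (Metric.thickening δ (K i)) (Metric.thickening δ (K j)) := by
    refine eventually_all.2 fun i => eventually_all.2 fun j => eventually_imp_distrib_left.2 ?_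
    intro hij
    obtain ⟨δ, hδ, h⟩ := (hd hij).exists_thickenings (hK i) (hK j).isClosed
    filter_upwards [Ioc_mem_nhdsGT hδ] with ε hε
    exact h.mono (Metric.thickening_mono hε.2 _) (Metric.thickening_mono hε.2 _)
  obtain ⟨δ, hδ, hδ0⟩ := (h1.and self_mem_nhdsWithin).exists
  let g : X → ι := fun y => if h : ∃ i, y ∈ Metric.thickening δ (K i) then h.choose
    else Classical.arbitrary ι
  refine ⟨δ, hδ0, g, fun i x hx y hxy => ?_⟩
  have h : ∃ i, y ∈ Metric.thickening δ (K i) := ⟨i, Metric.mem_thickening_iff.2 ⟨x, hx, hxy⟩⟩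
  have hgy : g y = h.choose := dif_pos h
  by_contra hne
  exact (hδ _ _ hne).notMem_of_mem_left (hgy ▸ h.choose_spec)
    (Metric.mem_thickening_iff.2 ⟨x, hx, hxy⟩)

theorem exists_sum_exp_neg_le {η : ℝ} (hη : 0 < η) :
    ∃ N : ℕ, 0 < N ∧ ∀ M, ∑ n ∈ Finset.Icc N M, Real.exp (-(n * η)) ≤ 1 / 2 := by
  have hs : Summable fun n : ℕ => Real.exp (-(n * η)) := by
    have := Real.summable_exp_nat_mul_iff.2 (neg_lt_zero.2 hη)
    simpa using this
  obtain ⟨s, hs⟩ := summable_iff_vanishing_norm.1 hs (1 / 2) (by norm_num)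
  refine ⟨s.sup id + 1, by omega, fun M => ?_⟩
  refine (le_abs_self _).trans (hs _ ?_).le
  refine Finset.disjoint_left.2 fun n hn hns => ?_
  have h1 : n ≤ s.sup id := Finset.le_sup (f := id) hns
  have h2 := (Finset.mem_Icc.1 hn).1
  omega

variable {X : Type*} [MetricSpace X] [SecondCountableTopology X] [CompleteSpace X]
  [MeasurableSpace X] [BorelSpace X]

/-- The code words are the decoded orbits of centres of dynamical balls. Decoding is reliable at
times when the orbit lies in compact cores of the cells of `f`, which exist by inner regularity. -/
theorem itineraryEntropy_le_lowerLocalEntropy {T : X → X} {μ : Measure X}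
    [IsProbabilityMeasure μ] (hT : Ergodic T μ) {ι : Type*} [Fintype ι] [MeasurableSpace ι]
    [MeasurableSingletonClass ι] {f : X → ι} (hf : Measurable f) :
    itineraryEntropy T μ f ≤ lowerLocalEntropy T μ := by
  classical
  have : Nonempty X := nonempty_of_isProbabilityMeasure μ
  inhabit X
  have : Nonempty ι := ⟨f default⟩
  refine EReal.le_of_forall_lt_iff_le.1 fun b hb => ?_
  have hb0 : 0 ≤ b := EReal.coe_nonneg.1 ((lowerLocalEntropy_nonneg T μ).trans hb.le)
  -- One `η` makes the code word probabilities summable, one pays for correct transmission through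
  -- the noisy channel, and one pays for the bad visits.
  suffices h : ∀ η : ℝ, 0 < η → itineraryEntropy T μ f ≤ ((b + 3 * η : ℝ) : EReal) by
    refine EReal.le_of_forall_lt_iff_le.1 fun z hz => ?_
    have := h ((z - b) / 3) (by have := EReal.coe_lt_coe_iff.1 hz; linarith)
    rwa [show b + 3 * ((z - b) / 3) = z by ring] at this
  intro η hη
  set ε : ℝ := 1 - Real.exp (-η) with hεdef
  have hε : 0 < ε := by
    rw [hεdef, sub_pos, Real.exp_lt_one_iff]
    linarith
  have hcard : (0 : ℝ) < Fintype.card ι := by positivity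
  -- `C` bounds the price of a letter that is spelled out singly and of a transmission error.
  set C : ℝ := max 0 (max (Real.log (2 * Fintype.card ι)) (-Real.log (ε / Fintype.card ι))) with hCdef
  have hC : 0 ≤ C := le_max_left _ _
  have hC1 : Real.exp (-C) ≤ 1 / (2 * Fintype.card ι) := by
    rw [← Real.le_log_iff_exp_le (by positivity), one_div, Real.log_inv]
    exact neg_le_neg ((le_max_left _ _).trans (le_max_right _ _))
  have hC2 : Real.exp (-C) ≤ ε / Fintype.card ι := by
    rw [← Real.le_log_iff_exp_le (by positivity), neg_le]
    exact (le_max_right _ _).trans (le_max_right _ _)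
  -- The bad set is a union of two sets of measure at most `θ`, so `C` times its measure is at most
  -- `η`.
  set θ : ℝ := η / (2 * (C + 1)) with hθdef
  have hθ : 0 < θ := by positivity
  have hfm : ∀ i, MeasurableSet (f ⁻¹' {i}) := fun i => hf (measurableSet_singleton i)
  have hK : ∀ i, ∃ K ⊆ f ⁻¹' {i}, IsCompact K ∧
      μ (f ⁻¹' {i} \ K) < ENNReal.ofReal (θ / Fintype.card ι) := fun i =>
    (hfm i).exists_isCompact_sdiff_lt (measure_ne_top _ _)
      (ENNReal.ofReal_pos.2 (by positivity)).ne'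
  choose K hKsub hKc hKμ using hK
  obtain ⟨δ, hδ, g, hg⟩ := exists_decoder hKc fun i j hij =>
    Disjoint.mono (hKsub i) (hKsub j) (Disjoint.preimage f (by simpa using hij))
  -- Covering doubles the radius, and the decoder tolerates errors below `δ`.
  set r : ℝ := δ / 2
  have hr : 0 < r := by positivity
  obtain ⟨N, hN, hNsum⟩ := exists_sum_exp_neg_le hη
  let G : ℕ → Set X := fun M =>
    {x | ∃ n, N ≤ n ∧ n ≤ M ∧ Real.exp (-(n * b)) ≤ μ.real (dynBall T n x r)}
  have hGm : ∀ M, MeasurableSet (G M) := by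
    intro M
    have : G M = ⋃ n : ℕ, ⋃ _ : N ≤ n, ⋃ _ : n ≤ M,
        {x | Real.exp (-(n * b)) ≤ μ.real (dynBall T n x r)} := by
      ext x
      simp only [G, mem_ofPred_eq, mem_iUnion, exists_prop]
    rw [this]
    exact .iUnion fun n => .iUnion fun _ => .iUnion fun _ =>
      measurableSet_le measurable_const (measurable_measureReal_dynBall hT.measurable μ n r)
  have hGmono : Monotone G := fun M M' h x ⟨n, h1, h2, h3⟩ => ⟨n, h1, h2.trans h, h3⟩
  have hGfull : μ (⋃ M, G M) = 1 := by
    rw [prob_compl_eq_zero_iff (.iUnion hGm) |>.symm, ← mem_ae_iff]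
    filter_upwards [ae_frequently_exp_le_measureReal_dynBall hT hb hr] with x hx
    obtain ⟨n, hn, hn'⟩ := frequently_atTop.1 hx N
    exact mem_iUnion.2 ⟨n, n, hn, le_rfl, hn'⟩
  obtain ⟨M, hM⟩ : ∃ M, μ.real (G M)ᶜ ≤ θ := by
    have h1 := tendsto_measure_iUnion_atTop (μ := μ) hGmono
    rw [hGfull] at h1
    have h2 := (ENNReal.tendsto_toReal ENNReal.one_ne_top).comp h1
    obtain ⟨M, hM⟩ := (h2.eventually_const_lt (u := 1 - θ) (by simpa using hθ)).exists
    refine ⟨M, ?_⟩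
    rw [probReal_compl_eq_one_sub (hGm M)]
    simp only [Function.comp_apply] at hM
    rw [measureReal_def]
    linarith
  choose Z hZcard hZ using fun n : ℕ =>
    exists_finset_cover_dynBall hT.measurable μ n hr (Real.exp_pos (-(n * b)))
  -- A point is bad if its letter cannot be decoded safely or if no block length in `[N, M]` suits
  -- it.
  let bad : Set X := (⋃ i, K i)ᶜ ∪ (G M)ᶜ
  have hKm : MeasurableSet (⋃ i, K i) := .iUnion fun i => (hKc i).measurableSet
  have hbad : MeasurableSet bad := hKm.compl.union (hGm M).compl
  have hbadμ : μ.real bad ≤ 2 * θ := by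
    have h1 : (⋃ i, K i)ᶜ ⊆ ⋃ i, f ⁻¹' {i} \ K i := by
      intro x hx
      refine mem_iUnion.2 ⟨f x, rfl, fun h => hx (mem_iUnion.2 ⟨_, h⟩)⟩
    have h2 : μ.real (⋃ i, K i)ᶜ ≤ θ := by
      calc μ.real (⋃ i, K i)ᶜ ≤ μ.real (⋃ i, f ⁻¹' {i} \ K i) := measureReal_mono h1
        _ ≤ ∑ i, μ.real (f ⁻¹' {i} \ K i) := measureReal_iUnion_fintype_le _
        _ ≤ ∑ _i : ι, θ / Fintype.card ι := Finset.sum_le_sum fun i _ =>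
            ENNReal.toReal_le_of_le_ofReal (by positivity) (hKμ i).le
        _ = θ := by
            rw [Finset.sum_const, Finset.card_univ, nsmul_eq_mul]
            field_simp
    linarith [measureReal_union_le (μ := μ) (⋃ i, K i)ᶜ (G M)ᶜ]
  let B : Finset (Σ _ : ℕ, X) := (Finset.Icc N M).sigma Z
  have key := itineraryEntropy_le_of_blocks (B := B) (len := fun p => p.1)
    (code := fun p j => g (T^[j] p.2)) (q := fun p => Real.exp (-(p.1 * (b + η))))
    (ε := ε) hT.toMeasurePreserving hf hbad (h := b + η) (γ := η) (C := C) (N := M)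
    (by positivity) hη.le hC hε.le (by rw [hεdef]; ring) hC1 hC2
    (fun _ _ => (Real.exp_pos _).le) ?_ ?_
  · refine key.trans (EReal.coe_le_coe_iff.2 ?_)
    have h1 : C * μ.real bad ≤ η := by
      calc C * μ.real bad ≤ (C + 1) * (2 * θ) := by gcongr; linarith
        _ = η := by rw [hθdef]; field_simp
    linarith
  · rw [Finset.sum_sigma]
    refine le_trans (Finset.sum_le_sum fun n _ => ?_) (hNsum M)
    simp only [Finset.sum_const, nsmul_eq_mul]
    calc (Z n).card * Real.exp (-(n * (b + η)))
        = (Z n).card * Real.exp (-(n * b)) * Real.exp (-(n * η)) := by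
          rw [mul_assoc, ← Real.exp_add]
          congr 2
          ring
      _ ≤ 1 * Real.exp (-(n * η)) := by gcongr; exact hZcard n
      _ = _ := one_mul _
  · intro x hx
    have hxG : x ∈ G M := by
      by_contra h
      exact hx (.inr h)
    obtain ⟨n, hNn, hnM, hxn⟩ := hxG
    obtain ⟨z, hz, hxz⟩ := hZ n x hxn
    refine ⟨⟨n, z⟩, Finset.mem_sigma.2 ⟨Finset.mem_Icc.2 ⟨hNn, hnM⟩, hz⟩, hN.trans_le hNn, hnM,
      le_rfl, fun j hj hjb => ?_⟩
    have hjK : T^[j] x ∈ ⋃ i, K i := by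
      by_contra h
      exact hjb (.inl h)
    obtain ⟨i, hi⟩ := mem_iUnion.1 hjK
    have h1 : f (T^[j] x) = i := hKsub i hi
    rw [h1]
    refine hg i _ hi _ ?_
    have h2 := hxz j hj
    rwa [show 2 * r = δ by simp only [r]; ring] at h2

theorem measureEntropy_le_lowerLocalEntropy {T : X → X} {μ : Measure X}
    [IsProbabilityMeasure μ] (hT : Ergodic T μ) :
    measureEntropy T μ ≤ lowerLocalEntropy T μ :=
  measureEntropy_le fun _ _ hf => itineraryEntropy_le_lowerLocalEntropy hT hf

/-! ### Entropy cost of merging cells -/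

section Refinement

variable {X ι κ : Type*} [MeasurableSpace X] [Fintype ι] [MeasurableSpace ι]
  [MeasurableSingletonClass ι] [Fintype κ] [DecidableEq κ] [MeasurableSpace κ]
  [MeasurableSingletonClass κ]

/-- The entropy of the itineraries of a map `p` compared with those of a coarser map `φ ∘ p`,
by means of conditional weights `w` on the fibres of `φ`. -/
theorem mapEntropy_itinerary_le {μ : Measure X} [IsProbabilityMeasure μ] {T : X → X}
    (hT : MeasurePreserving T μ μ) {p : X → ι} (hp : Measurable p) (φ : ι → κ) {w : ι → ℝ}
    (hw : ∀ a, 0 < w a) (hw1 : ∀ c, ∑ a with φ a = c, w a ≤ 1) (n : ℕ) :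
    mapEntropy μ (itinerary T p n) ≤
      mapEntropy μ (itinerary T (fun x => φ (p x)) n) + n * ∫ x, -Real.log (w (p x)) ∂μ := by
  classical
  have hq : Measurable fun x => φ (p x) := (measurable_of_finite φ).comp hp
  have hP := measurable_itinerary hT.measurable hp n
  have hQ := measurable_itinerary hT.measurable hq n
  let m : (Fin n → κ) → ℝ := fun v => μ.real (itinerary T (fun x => φ (p x)) n ⁻¹' {v})
  have hsub : ∀ u : Fin n → ι, itinerary T p n ⁻¹' {u} ⊆
      itinerary T (fun x => φ (p x)) n ⁻¹' {fun i => φ (u i)} := by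
    rintro u x rfl
    rfl
  have hmpos : ∀ u : Fin n → ι, 0 < μ.real (itinerary T p n ⁻¹' {u}) → 0 < m fun i => φ (u i) :=
    fun u hu => hu.trans_le (measureReal_mono (hsub u))
  have hprod : ∀ u : Fin n → ι, 0 < ∏ i, w (u i) := fun u => Finset.prod_pos fun i _ => hw _
  -- The guess for a fine word: the true probability of its coarse word, times independent
  -- conditional guesses `w` for the letters.
  have hsum : ∑ u : Fin n → ι, m (fun i => φ (u i)) * ∏ i, w (u i) ≤ 1 := by
    rw [← Finset.sum_fiberwise Finset.univ (fun (u : Fin n → ι) i => φ (u i))]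
    calc _ ≤ ∑ v : Fin n → κ, m v := Finset.sum_le_sum fun v _ => ?_
      _ = 1 := sum_measureReal_fiber hQ
    have h1 : (Finset.univ.filter fun u : Fin n → ι => (fun i => φ (u i)) = v) =
        Fintype.piFinset fun i => Finset.univ.filter fun a => φ a = v i := by
      ext u
      simp [Fintype.mem_piFinset, funext_iff]
    calc _ = ∑ u : Fin n → ι with (fun i => φ (u i)) = v, m v * ∏ i, w (u i) :=
          Finset.sum_congr rfl fun u hu => by rw [(Finset.mem_filter.1 hu).2]
      _ = m v * ∏ i, ∑ a with φ a = v i, w a := by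
          rw [← Finset.mul_sum, h1, ← Finset.prod_univ_sum]
      _ ≤ m v := mul_le_of_le_one_right measureReal_nonneg <| Finset.prod_le_one
          (fun i _ => Finset.sum_nonneg fun a _ => (hw a).le) fun i _ => hw1 _
  have hint : ∀ i : Fin n, Integrable (fun x => -Real.log (w (itinerary T p n x i))) μ := fun i =>
    integrable_comp_of_fintype hP fun u => -Real.log (w (u i))
  have hintv : ∀ i : Fin n, ∫ x, -Real.log (w (itinerary T p n x i)) ∂μ =
      ∫ x, -Real.log (w (p x)) ∂μ := by
    intro i
    have hm : AEStronglyMeasurable (fun x => -Real.log (w (p x))) (μ.map T^[i]) := by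
      rw [(hT.iterate i).map_eq]
      exact (integrable_comp_of_fintype hp fun a => -Real.log (w a)).aestronglyMeasurable
    conv_rhs => rw [← (hT.iterate i).map_eq, integral_map (hT.iterate i).aemeasurable hm]
    rfl
  calc mapEntropy μ (itinerary T p n)
      ≤ ∫ x, -Real.log ((fun u : Fin n → ι => m (fun i => φ (u i)) * ∏ i, w (u i))
          (itinerary T p n x)) ∂μ :=
        mapEntropy_le_integral hP (fun u => mul_nonneg measureReal_nonneg (hprod u).le)
          (fun u hu => mul_pos (hmpos u hu) (hprod u)) hsum
    _ = ∫ x, (-Real.log (m (itinerary T (fun x => φ (p x)) n x)) +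
          ∑ i, -Real.log (w (itinerary T p n x i))) ∂μ := by
        -- In the finite sum, words of measure zero contribute nothing; for the others both factors
        -- are positive and the logarithm splits.
        rw [integral_comp_of_fintype hP fun u =>
          -Real.log (m (fun i => φ (u i)) * ∏ i, w (u i))]
        refine Eq.trans (Finset.sum_congr rfl fun u _ => ?_) (integral_comp_of_fintype hP fun u =>
          -Real.log (m (fun i => φ (u i))) + ∑ i, -Real.log (w (u i))).symm
        rcases (measureReal_nonneg (μ := μ) (s := itinerary T p n ⁻¹' {u})).eq_or_lt with h | h
        · simp [← h]
        · rw [Real.log_mul (hmpos u h).ne' (hprod u).ne', Real.log_prod fun i _ => (hw _).ne',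
            Finset.sum_neg_distrib]
          ring
    _ = _ := by
        rw [integral_add, integral_finsetSum, mapEntropy_eq_integral hQ]
        · simp [hintv, m]
        · exact fun i _ => hint i
        · exact integrable_comp_of_fintype hQ fun v => -Real.log (m v)
        · exact integrable_finsetSum _ fun i _ => hint i

end Refinement

/-! ### Return times -/

section Return

variable {X : Type*}

/-- The points of `K` that do not return to `K` during the first `k` steps. -/
def noReturn (T : X → X) (K : Set X) (k : ℕ) : Set X :=
  {x | x ∈ K ∧ ∀ i, 1 ≤ i → i ≤ k → T^[i] x ∉ K}

open Classical in
/-- The first return time to `K`, capped at `n`; it is zero outside `K`. -/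
noncomputable def returnTime (T : X → X) (K : Set X) (n : ℕ) (x : X) : ℕ :=
  Nat.find (⟨n, .inl le_rfl⟩ : ∃ k, n ≤ k ∨ x ∉ noReturn T K k)

variable {T : X → X} {K : Set X} {n : ℕ} {x : X}

theorem returnTime_le : returnTime T K n x ≤ n := by
  classical
  exact Nat.find_min' _ (.inl le_rfl)

theorem mem_noReturn_of_lt_returnTime {k : ℕ} (h : k < returnTime T K n x) :
    x ∈ noReturn T K k := by
  classical
  by_contra hk
  exact Nat.find_min _ h (.inr hk)

theorem notMem_noReturn_returnTime (h : returnTime T K n x < n) :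
    x ∉ noReturn T K (returnTime T K n x) := by
  classical
  exact (Nat.find_spec (⟨n, .inl le_rfl⟩ : ∃ k, n ≤ k ∨ x ∉ noReturn T K k)).resolve_left
    (not_le.2 h)

theorem returnTime_pos (hn : 0 < n) (hx : x ∈ K) : 0 < returnTime T K n x := by
  by_contra! h
  have h0 : returnTime T K n x = 0 := by omega
  refine notMem_noReturn_returnTime (T := T) (h0 ▸ hn) ?_
  rw [h0]
  exact ⟨hx, fun i h1 h2 => by omega⟩

theorem mem_of_returnTime_pos (h : 0 < returnTime T K n x) : x ∈ K :=
  (mem_noReturn_of_lt_returnTime h).1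

theorem exists_iterate_mem_of_returnTime_lt (hx : x ∈ K) (h : returnTime T K n x < n) :
    ∃ i, 1 ≤ i ∧ i ≤ returnTime T K n x ∧ T^[i] x ∈ K := by
  by_contra! hne
  exact notMem_noReturn_returnTime h ⟨hx, hne⟩

/-- The cap matters only when it is reached: below it both values are the least `k` for which
`noReturn T K k` fails at `x`. -/
theorem returnTime_eq_of_lt {n' : ℕ} (hn : n ≤ n')
    (h : returnTime T K n x < n ∨ returnTime T K n' x < n) :
    returnTime T K n x = returnTime T K n' x := by
  rcases lt_trichotomy (returnTime T K n x) (returnTime T K n' x) with h1 | h1 | h1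
  · exact absurd (mem_noReturn_of_lt_returnTime h1) (notMem_noReturn_returnTime (by omega))
  · exact h1
  · exact absurd (mem_noReturn_of_lt_returnTime h1) (notMem_noReturn_returnTime (by omega))

variable [MeasurableSpace X]

theorem measurableSet_noReturn (hT : Measurable T) (hK : MeasurableSet K) (k : ℕ) :
    MeasurableSet (noReturn T K k) := by
  have : noReturn T K k = K ∩ ⋂ i : ℕ, ⋂ _ : 1 ≤ i, ⋂ _ : i ≤ k, T^[i] ⁻¹' Kᶜ := by
    ext x
    simp [noReturn]
  rw [this]
  exact hK.inter (.iInter fun i => .iInter fun _ => .iInter fun _ => hT.iterate i hK.compl)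

theorem measurable_returnTime (hT : Measurable T) (hK : MeasurableSet K) (n : ℕ) :
    Measurable (returnTime T K n) := by
  classical
  refine measurable_find _ fun k => ?_
  exact (MeasurableSet.const _).union (measurableSet_noReturn hT hK k).compl

/-- The sums of the measures of the sets of points with late returns are small. -/
theorem exists_sum_measureReal_noReturn_le {μ : Measure X} [IsProbabilityMeasure μ]
    (hT : MeasurePreserving T μ μ) (hK : MeasurableSet K) {δ : ℝ} (hδ : 0 < δ) :
    ∃ m, ∀ n, ∑ k ∈ Finset.Ico m n, μ.real (noReturn T K k) ≤ δ := by
  let V : ℕ → Set X := fun k => {x | ∀ i < k, T^[i] x ∉ K}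
  have hV : ∀ k, MeasurableSet (V k) := by
    intro k
    have : V k = ⋂ i : ℕ, ⋂ _ : i < k, T^[i] ⁻¹' Kᶜ := by
      ext x
      simp [V]
    rw [this]
    exact .iInter fun i => .iInter fun _ => hT.measurable.iterate i hK.compl
  -- `T ⁻¹' V k` consists of the points avoiding `K` at times `1, …, k`; splitting it by whether
  -- time zero lies in `K` and using invariance makes the sums telescope.
  have hstep : ∀ k, μ.real (noReturn T K k) = μ.real (V k) - μ.real (V (k + 1)) := by
    intro k
    have h1 : T ⁻¹' V k = noReturn T K k ∪ V (k + 1) := by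
      ext x
      simp only [V, noReturn, mem_preimage, mem_ofPred_eq, mem_union, ← Function.iterate_succ_apply]
      constructor
      · intro h
        by_cases hx : x ∈ K
        · refine .inl ⟨hx, fun i h1 h2 => ?_⟩
          obtain ⟨i, rfl⟩ : ∃ j, i = j + 1 := ⟨i - 1, by omega⟩
          exact h i (by omega)
        · refine .inr fun i hi => ?_
          cases i with
          | zero => exact hx
          | succ i => exact h i (by omega)
      · rintro (h | h) i hi
        · exact h.2 (i + 1) (by omega) (by omega)
        · exact h (i + 1) (by omega)
    have h2 : Disjoint (noReturn T K k) (V (k + 1)) :=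
      Set.disjoint_left.2 fun x hx hx' => hx' 0 (by omega) hx.1
    rw [← hT.measureReal_preimage (hV k).nullMeasurableSet, h1, measureReal_union h2 (hV _)]
    ring
  have hanti : Antitone fun k => μ.real (V k) := fun k l h =>
    measureReal_mono fun x hx i hi => hx i (hi.trans_le h)
  have hbdd : BddBelow (range fun k => μ.real (V k)) :=
    ⟨0, by rintro _ ⟨k, rfl⟩; exact measureReal_nonneg⟩
  have hlim := tendsto_atTop_ciInf hanti hbdd
  obtain ⟨m, hm⟩ := (hlim.eventually_lt_const (lt_add_of_pos_right _ hδ)).exists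
  refine ⟨m, fun n => ?_⟩
  rcases le_total n m with h | h
  · simp [Finset.Ico_eq_empty_of_le h, hδ.le]
  · simp_rw [hstep]
    rw [Finset.sum_Ico_eq_sub _ h, Finset.sum_range_sub', Finset.sum_range_sub']
    linarith [ciInf_le hbdd n]

/-- The integral of the return time over the set where it exceeds `2 * m`. -/
theorem integral_indicator_returnTime_le {μ : Measure X} [IsProbabilityMeasure μ]
    (hT : Measurable T) (hK : MeasurableSet K) (m n : ℕ) :
    ∫ x, (if returnTime T K n x ≤ 2 * m then 0 else (returnTime T K n x : ℝ)) ∂μ ≤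
      2 * ∑ k ∈ Finset.Ico m n, μ.real (noReturn T K k) := by
  have hR := measurableSet_noReturn hT hK
  have hint : ∀ k, Integrable ((noReturn T K k).indicator (1 : X → ℝ)) μ := fun k =>
    (integrable_const 1).indicator (hR k)
  calc _ ≤ ∫ x, 2 * ∑ k ∈ Finset.Ico m n, (noReturn T K k).indicator (1 : X → ℝ) x ∂μ := by
        refine integral_mono_of_nonneg (Eventually.of_forall fun x => ?_)
          ((integrable_finsetSum _ fun k _ => hint k).const_mul 2)
          (Eventually.of_forall fun x => ?_)
        · dsimp only
          split_ifs <;> positivity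
        · dsimp only
          have h0 : ∀ k, 0 ≤ (noReturn T K k).indicator (1 : X → ℝ) x := fun k =>
            indicator_nonneg (fun _ _ => zero_le_one) x
          split_ifs with h
          · exact mul_nonneg zero_le_two (Finset.sum_nonneg fun k _ => h0 k)
          -- For a return time `τ > 2 * m` one has `τ ≤ 2 * (τ - m)`, and `τ - m` counts those `k ≥
          -- m` below `τ`, at all of which there is no return yet.
          · have h1 : ∑ k ∈ Finset.Ico m (returnTime T K n x), (1 : ℝ) ≤
                ∑ k ∈ Finset.Ico m n, (noReturn T K k).indicator (1 : X → ℝ) x := by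
              refine le_trans (Finset.sum_le_sum fun k hk => ?_)
                (Finset.sum_le_sum_of_subset_of_nonneg
                  (Finset.Ico_subset_Ico_right returnTime_le) fun k _ _ => h0 k)
              rw [indicator_of_mem (mem_noReturn_of_lt_returnTime (Finset.mem_Ico.1 hk).2)]
              rfl
            rw [Finset.sum_const, Nat.card_Ico, nsmul_eq_mul, mul_one,
              Nat.cast_sub (by omega)] at h1
            have h2 : (2 * m : ℝ) ≤ returnTime T K n x := by
              exact_mod_cast (not_le.1 h).le
            linarith
    _ = _ := by
        rw [integral_const_mul, integral_finsetSum _ fun k _ => hint k]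
        simp only [integral_indicator_one (hR _)]

end Return

/-! ### Cells of the return-time partition -/

/-- Cells labelled by a return time and by an index at the corresponding scale. -/
def ReturnCell (N : ℕ → ℕ) (n : ℕ) : Type :=
  Σ k : Fin (n + 1), Fin (N k)

namespace ReturnCell

variable {N : ℕ → ℕ} {n : ℕ}

instance : Fintype (ReturnCell N n) :=
  inferInstanceAs (Fintype (Σ k : Fin (n + 1), Fin (N k)))

instance : MeasurableSpace (ReturnCell N n) := ⊤

instance : MeasurableSingletonClass (ReturnCell N n) := ⟨fun _ => trivial⟩

/-- Merge all the cells with return time larger than `l`. -/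
def truncate (l : ℕ) (s : ReturnCell N n) : Option (ReturnCell N l) :=
  if h : (s.1 : ℕ) ≤ l then some ⟨⟨s.1, Nat.lt_succ_of_le h⟩, s.2⟩ else none

/-- Conditional weights of the cells that are merged by `truncate`. -/
noncomputable def weight (l : ℕ) (s : ReturnCell N n) : ℝ :=
  if (s.1 : ℕ) ≤ l then 1 else (1 / 2) ^ (s.1 : ℕ) / N s.1

theorem weight_pos (hN : ∀ k, 0 < N k) (l : ℕ) (s : ReturnCell N n) : 0 < weight l s := by
  unfold weight
  have : (0 : ℝ) < N s.1 := by exact_mod_cast hN _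
  split_ifs <;> positivity

theorem eq_of_truncate_eq_some {l : ℕ} {s s' : ReturnCell N n} {c : ReturnCell N l}
    (h : truncate l s = some c) (h' : truncate l s' = some c) : s = s' := by
  obtain ⟨⟨k, hk⟩, i⟩ := s
  obtain ⟨⟨k', hk'⟩, i'⟩ := s'
  unfold truncate at h h'
  split_ifs at h h' with h1 h2
  obtain ⟨h3, h4⟩ := Sigma.mk.inj_iff.1 (Option.some.inj (h'.trans h.symm))
  obtain rfl : k' = k := congrArg Fin.val h3
  obtain rfl : i' = i := eq_of_heq h4
  rfl

/-- Truncation is injective on unmerged cells, which have weight one. On the merged ones the `N k`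
indices share the mass `2 ^ (-k)`, and these masses form a geometric series. -/
theorem sum_weight_le_one (hN : ∀ k, 0 < N k) (l : ℕ) [DecidableEq (Option (ReturnCell N l))]
    (c : Option (ReturnCell N l)) :
    ∑ s : ReturnCell N n with truncate l s = c, weight l s ≤ 1 := by
  cases c with
  | some c =>
    calc ∑ s : ReturnCell N n with truncate l s = some c, weight l s
        ≤ ∑ s : ReturnCell N n with truncate l s = some c, (1 : ℝ) := by
          refine Finset.sum_le_sum fun s hs => ?_
          have h1 := (Finset.mem_filter.1 hs).2
          unfold truncate at h1
          split_ifs at h1 with h2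
          rw [weight, if_pos h2]
      _ ≤ 1 := by
          rw [Finset.sum_const, nsmul_eq_mul, mul_one]
          have : (Finset.univ.filter fun s : ReturnCell N n => truncate l s = some c).card ≤ 1 :=
            Finset.card_le_one.2 fun s hs s' hs' =>
              eq_of_truncate_eq_some (Finset.mem_filter.1 hs).2 (Finset.mem_filter.1 hs').2
          exact_mod_cast this
  | none =>
    calc ∑ s : ReturnCell N n with truncate l s = none, weight l s
        ≤ ∑ s : ReturnCell N n with truncate l s = none,
            (if (s.1 : ℕ) ≤ l then 0 else (1 / 2 : ℝ) ^ (s.1 : ℕ) / N s.1) := by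
          refine Finset.sum_le_sum fun s hs => ?_
          have h1 := (Finset.mem_filter.1 hs).2
          unfold truncate at h1
          split_ifs at h1 with h2
          rw [weight, if_neg h2, if_neg h2]
      _ ≤ ∑ s : ReturnCell N n,
            (if (s.1 : ℕ) ≤ l then 0 else (1 / 2 : ℝ) ^ (s.1 : ℕ) / N s.1) :=
          Finset.sum_le_sum_of_subset_of_nonneg (Finset.filter_subset _ _) fun s _ _ => by
            split_ifs <;> positivity
      _ = ∑ k : Fin (n + 1), ∑ _i : Fin (N k),
            (if (k : ℕ) ≤ l then 0 else (1 / 2 : ℝ) ^ (k : ℕ) / N k) := Fintype.sum_sigma _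
      _ = ∑ k : Fin (n + 1), (if (k : ℕ) ≤ l then 0 else (1 / 2 : ℝ) ^ (k : ℕ)) := by
          refine Finset.sum_congr rfl fun k _ => ?_
          have : (N k : ℝ) ≠ 0 := by exact_mod_cast (hN k).ne'
          rw [Finset.sum_const, Finset.card_univ, Fintype.card_fin, nsmul_eq_mul]
          split_ifs
          · simp
          · field_simp
      _ ≤ ∑ k : Fin n, (1 / 2 : ℝ) ^ ((k : ℕ) + 1) := by
          rw [Fin.sum_univ_succ]
          simp only [Fin.val_zero, Nat.zero_le, if_true, zero_add, Fin.val_succ]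
          refine Finset.sum_le_sum fun k _ => ?_
          split_ifs
          · positivity
          · exact le_rfl
      _ = (∑ k ∈ Finset.range n, (1 / 2 : ℝ) ^ k) / 2 := by
          rw [Fin.sum_univ_eq_sum_range fun k => (1 / 2 : ℝ) ^ (k + 1), Finset.sum_div]
          exact Finset.sum_congr rfl fun k _ => by rw [pow_succ]; ring
      _ ≤ 1 := by linarith [sum_geometric_two_le n]

/-- A merged cell costs `k * log 2 + log (N k) ≤ k + c * (k + 1)`, and `k ≥ 1` there. A cost linear
in the return time is what the summability of late returns can control. -/
theorem neg_log_weight_le {c : ℝ} (hc : 0 ≤ c) (hN : ∀ k, 0 < N k)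
    (hNc : ∀ k : ℕ, Real.log (N k) ≤ c * (k + 1)) (l : ℕ) (s : ReturnCell N n) :
    -Real.log (weight l s) ≤ (1 + 2 * c) * if (s.1 : ℕ) ≤ l then 0 else ((s.1 : ℕ) : ℝ) := by
  unfold weight
  split_ifs with h
  · simp
  · have h1 : (1 : ℝ) ≤ (s.1 : ℕ) := by
      have : 1 ≤ (s.1 : ℕ) := by omega
      exact_mod_cast this
    have h2 : (N s.1 : ℝ) ≠ 0 := by exact_mod_cast (hN s.1).ne'
    rw [Real.log_div (by positivity) h2, Real.log_pow, one_div, Real.log_inv]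
    have h3 := hNc s.1
    have h4 := Real.log_two_lt_d9
    nlinarith

end ReturnCell

section Cell

variable {X : Type*}

/-- The cell of a point, given by its return time to `K` (capped at `n`) and its index. -/
noncomputable def returnCell (T : X → X) (K : Set X) {N : ℕ → ℕ} (g : ∀ k, X → Fin (N k)) (n : ℕ)
    (x : X) : ReturnCell N n :=
  ⟨⟨returnTime T K n x, Nat.lt_succ_of_le returnTime_le⟩, g (returnTime T K n x) x⟩

variable {T : X → X} {K : Set X} {N : ℕ → ℕ} {g : ∀ k, X → Fin (N k)}

theorem measurable_returnCell [MeasurableSpace X] (hT : Measurable T) (hK : MeasurableSet K)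
    (hg : ∀ k, Measurable (g k)) (n : ℕ) : Measurable (returnCell T K g n) := by
  refine measurable_to_countable' fun s => ?_
  have : returnCell T K g n ⁻¹' {s} =
      returnTime T K n ⁻¹' {(s.1 : ℕ)} ∩ g s.1 ⁻¹' {s.2} := by
    obtain ⟨⟨k, hk⟩, i⟩ := s
    ext x
    simp only [mem_preimage, mem_singleton_iff, mem_inter_iff, returnCell]
    constructor
    · intro h
      obtain ⟨h3, h4⟩ := Sigma.mk.inj_iff.1 h
      obtain rfl : returnTime T K n x = k := congrArg Fin.val h3
      exact ⟨rfl, eq_of_heq h4⟩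
    · rintro ⟨rfl, rfl⟩
      rfl
  rw [this]
  exact (measurable_returnTime hT hK n (measurableSet_singleton _)).inter
    (hg _ (measurableSet_singleton _))

/-- Once late returns are merged the cap is no longer visible, so partitions with a cap depending on
`n` all refine one fixed finite partition. -/
theorem truncate_returnCell_eq {l n n' : ℕ} (hl : l < n) (hn : n ≤ n') (x : X) :
    (returnCell T K g n' x).truncate l = (returnCell T K g n x).truncate l := by
  let ψ : ℕ → Option (ReturnCell N l) := fun k =>
    if h : k ≤ l then some ⟨⟨k, Nat.lt_succ_of_le h⟩, g k x⟩ else none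
  change ψ (returnTime T K n' x) = ψ (returnTime T K n x)
  by_cases h : returnTime T K n x < n ∨ returnTime T K n' x < n
  · rw [returnTime_eq_of_lt hn h]
  · push Not at h
    simp only [ψ]
    rw [dif_neg (by omega), dif_neg (by omega)]

/-- Points of `K` with the same itinerary of cells stay close to each other. -/
theorem itinerary_returnCell_fiber_subset [MetricSpace X] {L : ℕ} (hL : 0 < L) (hT : LipschitzWith L T) {r : ℝ}
    (hgr : ∀ k, ∀ x ∈ K, ∀ y ∈ K, g k x = g k y → L ^ k * dist x y < r) (n : ℕ) {x : X}
    (hx : x ∈ K) :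
    itinerary T (returnCell T K g n) n ⁻¹' {itinerary T (returnCell T K g n) n x} ⊆
      dynBall T n x r := by
  intro y hy
  have hcell : ∀ i < n, returnCell T K g n (T^[i] y) = returnCell T K g n (T^[i] x) :=
    fun i hi => congrFun hy ⟨i, hi⟩
  have hL1 : (1 : ℝ) ≤ L := by exact_mod_cast hL
  -- Induction on the time left after a visit to `K`. The common cell at time `s` gives closeness of
  -- order `r / L ^ t`, which the Lipschitz bound turns into closeness through time `s + t`.
  have key : ∀ d s, n - s = d → T^[s] x ∈ K → ∀ j, s ≤ j → j < n →
      dist (T^[j] x) (T^[j] y) < r := by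
    intro d
    induction d using Nat.strong_induction_on with
    | _ d ih =>
      intro s hsd hs j hsj hjn
      have hsn : s < n := by omega
      obtain ⟨h1, h2⟩ := Sigma.mk.inj_iff.1 (hcell s hsn)
      have h3 : returnTime T K n (T^[s] y) = returnTime T K n (T^[s] x) := congrArg Fin.val h1
      have hg' : ∀ k k', k = k' → HEq (g k (T^[s] y)) (g k' (T^[s] x)) →
          g k' (T^[s] x) = g k' (T^[s] y) := by
        rintro k _ rfl h
        exact (eq_of_heq h).symm
      have h2' := hg' _ _ h3 h2
      set t := returnTime T K n (T^[s] x) with ht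
      have ht0 : 0 < t := returnTime_pos (by omega) hs
      -- The return time vanishes outside `K`, so the common cell also records that the second orbit
      -- is in `K`, as the mesh condition requires.
      have hys : T^[s] y ∈ K := mem_of_returnTime_pos (h3 ▸ ht0)
      have h4 := hgr t _ hs _ hys h2'
      have hclose : ∀ i ≤ t, dist (T^[i] (T^[s] x)) (T^[i] (T^[s] y)) < r := by
        intro i hi
        refine lt_of_le_of_lt ((hT.iterate i).dist_le_mul _ _) (lt_of_le_of_lt ?_ h4)
        push_cast
        gcongr
      obtain ⟨i, rfl⟩ : ∃ i, j = i + s := ⟨j - s, by omega⟩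
      by_cases hit : i ≤ t
      · rw [Function.iterate_add_apply, Function.iterate_add_apply]
        exact hclose i hit
      -- Here `t < i < n`, so the cap was not reached and there is a genuine return by time `t`,
      -- from which the induction continues.
      · obtain ⟨i', h5, h6, h7⟩ := exists_iterate_mem_of_returnTime_lt hs
          (by omega : returnTime T K n (T^[s] x) < n)
        rw [← Function.iterate_add_apply] at h7
        exact ih (n - (i' + s)) (by omega) _ rfl h7 _ (by omega) hjn
  exact fun j hj => key n 0 (by omega) hx j (by omega) hj

end Cell

/-! ### Local entropy is at most entropy -/

variable {X : Type*} [MetricSpace X] [MeasurableSpace X] [BorelSpace X]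

/-- A finite cover by closed balls gives a measurable map to a finite type whose fibres are, inside
the covered set, contained in these balls. -/
theorem exists_measurable_index {K : Set X} (F : Finset X) {ρ : ℝ}
    (hF : K ⊆ ⋃ z ∈ F, Metric.closedBall z ρ) :
    ∃ g : X → Fin (F.card + 1), Measurable g ∧
      ∀ x ∈ K, ∀ y ∈ K, g x = g y → dist x y ≤ 2 * ρ := by
  classical
  let z : Fin F.card → X := fun j => F.equivFin.symm j
  -- The index is the first ball containing the point; the extra value `F.card` collects the points
  -- in no ball, whence `F.card + 1` cells.
  let P : X → ℕ → Prop := fun x j => F.card ≤ j ∨ ∃ h : j < F.card, dist x (z ⟨j, h⟩) ≤ ρ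
  have hP : ∀ x, ∃ j, P x j := fun x => ⟨F.card, .inl le_rfl⟩
  have hle : ∀ x, Nat.find (hP x) < F.card + 1 := fun x =>
    Nat.lt_succ_of_le (Nat.find_min' _ (.inl le_rfl))
  have hm : Measurable fun x => Nat.find (hP x) := by
    refine measurable_find _ fun j => ?_
    by_cases h : j < F.card
    · have : {x | P x j} = Metric.closedBall (z ⟨j, h⟩) ρ := by
        ext x
        simp [P, h]
      rw [this]
      exact Metric.isClosed_closedBall.measurableSet
    · have : {x | P x j} = univ := by
        ext x
        simp [P, not_lt.1 h]
      rw [this]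
      exact .univ
  have hlt : ∀ x ∈ K, Nat.find (hP x) < F.card := by
    intro x hx
    obtain ⟨y, hy, hxy⟩ := mem_iUnion₂.1 (hF hx)
    let j := F.equivFin ⟨y, hy⟩
    refine lt_of_le_of_lt (Nat.find_min' (hP x) (m := j) (.inr ⟨j.2, ?_⟩)) j.2
    simpa [z, j] using hxy
  refine ⟨fun x => Fin.ofNat (F.card + 1) (Nat.find (hP x)),
    (measurable_from_top (f := Fin.ofNat (F.card + 1))).comp hm, fun x hx y hy hxy => ?_⟩
  have heq : Nat.find (hP x) = Nat.find (hP y) := by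
    have := congrArg Fin.val hxy
    simpa only [Fin.ofNat, Nat.mod_eq_of_lt (hle x), Nat.mod_eq_of_lt (hle y)] using this
  obtain ⟨h1, h2⟩ := (Nat.find_spec (hP x)).resolve_left (not_le.2 (hlt x hx))
  obtain ⟨h3, h4⟩ := (Nat.find_spec (hP y)).resolve_left (not_le.2 (hlt y hy))
  simp only [← heq] at h4
  linarith [dist_triangle_right x y (z ⟨Nat.find (hP x), h1⟩)]

/-- For a set with polynomial covers, partitions of exponentially decreasing mesh can be chosen
with exponentially many cells. -/
theorem _root_.HasPolynomialCover.exists_index {K : Set X} (hK : HasPolynomialCover K) {L : ℕ}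
    (hL : 0 < L) {r : ℝ} (hr : 0 < r) :
    ∃ (N : ℕ → ℕ) (g : ∀ k, X → Fin (N k)) (c : ℝ), 0 ≤ c ∧ (∀ k, Measurable (g k)) ∧
      (∀ k, 0 < N k) ∧ (∀ k : ℕ, Real.log (N k) ≤ c * (k + 1)) ∧
      ∀ k, ∀ x ∈ K, ∀ y ∈ K, g k x = g k y → L ^ k * dist x y < r := by
  obtain ⟨C, D, h⟩ := hK
  obtain ⟨R, hR⟩ := exists_nat_gt (2 / r)
  have hR0 : 0 < R := by
    have : (0 : ℝ) < R := lt_trans (by positivity) hR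
    exact_mod_cast this
  -- Balls of radius `1 / (R * L ^ k)` give cells of diameter at most `2 / (R * L ^ k) < r / L ^ k`;
  -- a polynomial in `R * L ^ k` is exponential in `k`.
  choose F hFc hF using fun k : ℕ => h (R * L ^ k) (by positivity)
  choose g hg hgd using fun k => exists_measurable_index (F k) (hF k)
  have hL1 : (1 : ℝ) ≤ L := by exact_mod_cast hL
  refine ⟨fun k => (F k).card + 1, g, Real.log (C * R ^ D + 1) + D * Real.log L, ?_, hg,
    fun k => Nat.succ_pos _, fun k => ?_, fun k x hx y hy hxy => ?_⟩
  · have h1 : 0 ≤ Real.log (C * R ^ D + 1) := Real.log_nonneg (by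
      have : (0 : ℝ) ≤ C * R ^ D := by positivity
      linarith)
    have h2 : 0 ≤ Real.log L := Real.log_nonneg hL1
    positivity
  · have h1 : (((F k).card + 1 : ℕ) : ℝ) ≤ (C * R ^ D + 1) * (L ^ k) ^ D := by
      have h2 : ((F k).card : ℝ) ≤ C * (R * L ^ k) ^ D := by exact_mod_cast hFc k
      have h3 : (1 : ℝ) ≤ (L ^ k) ^ D := one_le_pow₀ (one_le_pow₀ hL1)
      push_cast
      calc ((F k).card : ℝ) + 1 ≤ C * (R * L ^ k) ^ D + (L ^ k) ^ D := add_le_add h2 h3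
        _ = _ := by ring
    have h0 : (0 : ℝ) < C * R ^ D + 1 := by positivity
    have hLpos : (0 : ℝ) < L := by linarith
    have h4 := Real.log_le_log (by positivity) h1
    rw [Real.log_mul h0.ne' (by positivity), Real.log_pow, Real.log_pow] at h4
    have h5 : 0 ≤ Real.log (C * R ^ D + 1) := Real.log_nonneg (by
      have : (0 : ℝ) ≤ C * R ^ D := by positivity
      linarith)
    have h6 : 0 ≤ D * Real.log L := mul_nonneg D.cast_nonneg (Real.log_nonneg hL1)
    have h7 : (0 : ℝ) ≤ k := k.cast_nonneg
    refine h4.trans ?_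
    nlinarith [mul_nonneg h5 h7]
  · have h1 := hgd k x hx y hy hxy
    have hLk : (0 : ℝ) < L ^ k := by positivity
    calc (L : ℝ) ^ k * dist x y ≤ L ^ k * (2 * (1 / (R * L ^ k : ℕ))) := by gcongr
      _ = 2 / R := by
          push_cast
          field_simp
      _ < r := by
          rw [div_lt_iff₀ (by exact_mod_cast hR0)]
          rw [div_lt_iff₀ hr] at hR
          linarith

/-- If the dynamical balls about the points of `E` are exponentially small, then the entropy is
large. -/
theorem mul_measureReal_sub_le_measureEntropy {μ : Measure X} [IsProbabilityMeasure μ]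
    {T : X → X} (hμ : MeasurePreserving T μ μ) {L : ℕ} (hL : 0 < L) (hT : LipschitzWith L T)
    {K : Set X} (hK : MeasurableSet K) (hKcov : HasPolynomialCover K) {E : Set X} (hE : E ⊆ K)
    {r : ℝ} (hr : 0 < r) {a : ℝ} (ha : 0 ≤ a) {n₀ : ℕ}
    (hball : ∀ x ∈ E, ∀ n ≥ n₀, μ.real (dynBall T n x r) ≤ Real.exp (-(n * a)))
    {ε : ℝ} (hε : 0 < ε) :
    ((a * μ.real E - ε : ℝ) : EReal) ≤ measureEntropy T μ := by
  classical
  obtain ⟨N, g, c, hc, hg, hN, hNc, hgr⟩ := hKcov.exists_index hL hr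
  -- The tolerance anticipates the factor `1 + 2 * c` of `ReturnCell.neg_log_weight_le` and the
  -- factor `2` of `integral_indicator_returnTime_le`.
  obtain ⟨m, hm⟩ := exists_sum_measureReal_noReturn_le hμ hK
    (by positivity : 0 < ε / (2 * (1 + 2 * c)))
  let p := returnCell T K g
  have hp : ∀ n, Measurable (p n) := measurable_returnCell hμ.measurable hK hg
  let : MeasurableSpace (Option (ReturnCell N (2 * m))) := ⊤
  have : MeasurableSingletonClass (Option (ReturnCell N (2 * m))) := ⟨fun _ => trivial⟩
  -- `2 * m + 1` is the least cap for which truncation at `2 * m` is independent of the cap.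
  let q : X → Option (ReturnCell N (2 * m)) := fun x => (p (2 * m + 1) x).truncate (2 * m)
  have hq : Measurable q := (measurable_of_finite (ReturnCell.truncate (2 * m))).comp (hp (2 * m + 1))
  have hcost : ∀ n, ∫ x, -Real.log ((p n x).weight (2 * m)) ∂μ ≤ ε := by
    intro n
    calc _ ≤ ∫ x, (1 + 2 * c) * (if returnTime T K n x ≤ 2 * m then 0
            else (returnTime T K n x : ℝ)) ∂μ :=
          integral_mono
            (integrable_comp_of_fintype (hp n) fun s => -Real.log (s.weight (2 * m)))
            (integrable_comp_of_fintype (hp n) fun s =>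
              (1 + 2 * c) * if (s.1 : ℕ) ≤ 2 * m then 0 else ((s.1 : ℕ) : ℝ))
            fun x => ReturnCell.neg_log_weight_le hc hN hNc (2 * m) (p n x)
      _ ≤ (1 + 2 * c) * (2 * (ε / (2 * (1 + 2 * c)))) := by
          rw [integral_const_mul]
          gcongr
          exact (integral_indicator_returnTime_le hμ.measurable hK m n).trans
            (mul_le_mul_of_nonneg_left (hm n) zero_le_two)
      _ = ε := by field_simp
  have key : ∀ n ≥ max n₀ (2 * m + 1),
      a * μ.real E - ε ≤ mapEntropy μ (itinerary T q n) / n := by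
    intro n hn
    have hn0 : n₀ ≤ n := (le_max_left _ _).trans hn
    have hn1 : 2 * m + 1 ≤ n := (le_max_right _ _).trans hn
    have hnpos : (0 : ℝ) < n := by exact_mod_cast (by omega : 0 < n)
    -- At time `n` the partition with cap `n` is used, since its itineraries control the orbit for
    -- all `n` steps; passing to the fixed partition `q` then costs at most `n * ε`.
    have h1 : n * a * μ.real E ≤ mapEntropy μ (itinerary T (p n) n) :=
      mul_measureReal_le_mapEntropy _ (by positivity) fun x hx =>
        (measureReal_mono (itinerary_returnCell_fiber_subset hL hT hgr n (hE hx))).trans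
          (hball x hx n hn0)
    have h2 := mapEntropy_itinerary_le hμ (hp n) (ReturnCell.truncate (2 * m))
      (ReturnCell.weight_pos hN (2 * m)) (ReturnCell.sum_weight_le_one hN (2 * m)) n
    have h3 : (fun x => (p n x).truncate (2 * m)) = q :=
      funext fun x => truncate_returnCell_eq (by omega) hn1 x
    rw [h3] at h2
    have h4 := mul_le_mul_of_nonneg_left (hcost n) hnpos.le
    rw [le_div_iff₀ hnpos]
    linarith
  refine le_trans ?_ (itineraryEntropy_le_measureEntropy T μ hq)
  refine le_limsup_of_frequently_le (Eventually.frequently ?_)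
  filter_upwards [eventually_ge_atTop (max n₀ (2 * m + 1))] with n hn
  exact EReal.coe_le_coe_iff.2 (key n hn)

/-- Below the essential infimum, almost all points have exponentially small dynamical balls at some
scale and from some time on. A single scale and time serve a set of nearly full measure, which is
intersected with a large compact set. -/
theorem lowerLocalEntropy_le_measureEntropy [SecondCountableTopology X] [CompleteSpace X]
    {μ : Measure X} [IsProbabilityMeasure μ] {T : X → X} (hμ : MeasurePreserving T μ μ)
    {L : ℝ≥0} (hT : LipschitzWith L T)
    (hcov : ∀ K : Set X, IsCompact K → HasPolynomialCover K) :
    lowerLocalEntropy T μ ≤ measureEntropy T μ := by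
  refine EReal.ge_of_forall_gt_iff_ge.1 fun a ha => ?_
  rcases lt_or_ge a 0 with ha0 | ha0
  · exact (EReal.coe_le_coe_iff.2 ha0.le).trans (measureEntropy_nonneg T μ)
  obtain ⟨L', hL'⟩ := exists_nat_ge L
  have hT' : LipschitzWith ((L' + 1 : ℕ) : ℝ≥0) T := hT.weaken (hL'.trans (by simp))
  -- One parameter governs both the starting time and the radius, so that the sets increase to a set
  -- of full measure.
  let E : ℕ → Set X := fun N =>
    {x | ∀ n ≥ N, μ.real (dynBall T n x (1 / (N + 1))) ≤ Real.exp (-(n * a))}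
  have hEmono : Monotone E := by
    intro N M h x hx n hn
    refine (measureReal_mono (dynBall_mono T n x ?_)).trans (hx n (h.trans hn))
    gcongr
  have hEm : ∀ N, MeasurableSet (E N) := by
    intro N
    have : E N = ⋂ n : ℕ, ⋂ _ : n ≥ N,
        {x | μ.real (dynBall T n x (1 / (N + 1))) ≤ Real.exp (-(n * a))} := by
      ext x
      simp [E]
    rw [this]
    exact .iInter fun n => .iInter fun _ =>
      measurableSet_le (measurable_measureReal_dynBall hμ.measurable μ n _) measurable_const
  have hEfull : μ (⋃ N, E N) = 1 := by
    rw [prob_compl_eq_zero_iff (.iUnion hEm) |>.symm, ← mem_ae_iff]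
    filter_upwards [ae_lt_of_lt_essInf ha] with x hx
    obtain ⟨⟨r, hr⟩, hx⟩ := lt_iSup_iff.1 hx
    obtain ⟨N, hN⟩ := eventually_atTop.1 (eventually_of_lt_lowerLocalEntropyAtScale hx)
    obtain ⟨M, hM⟩ := exists_nat_one_div_lt (mem_Ioi.1 hr)
    refine mem_iUnion.2 ⟨max N M, fun n hn => ?_⟩
    refine (measureReal_mono (dynBall_mono T n x ?_)).trans (hN n ((le_max_left _ _).trans hn)).le
    refine le_trans ?_ hM.le
    gcongr
    exact le_max_right _ _
  have key : ∀ δ : ℝ, 0 < δ → ((a * (1 - 2 * δ) - δ : ℝ) : EReal) ≤ measureEntropy T μ := by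
    intro δ hδ
    obtain ⟨N, hN⟩ : ∃ N, μ.real (E N)ᶜ ≤ δ := by
      have h1 := tendsto_measure_iUnion_atTop (μ := μ) hEmono
      rw [hEfull] at h1
      have h2 := (ENNReal.tendsto_toReal ENNReal.one_ne_top).comp h1
      obtain ⟨N, hN⟩ := (h2.eventually_const_lt (u := 1 - δ) (by simpa using hδ)).exists
      refine ⟨N, ?_⟩
      rw [probReal_compl_eq_one_sub (hEm N)]
      simp only [Function.comp_apply] at hN
      rw [measureReal_def]
      linarith
    obtain ⟨K, -, hKc, hKμ⟩ := MeasurableSet.univ.exists_isCompact_sdiff_lt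
      (measure_ne_top μ univ) (ENNReal.ofReal_pos.2 hδ).ne'
    have hK' : μ.real Kᶜ ≤ δ := by
      rw [compl_eq_univ_sdiff]
      exact ENNReal.toReal_le_of_le_ofReal hδ.le hKμ.le
    have hEK : 1 - 2 * δ ≤ μ.real (E N ∩ K) := by
      have h1 := probReal_compl_eq_one_sub (μ := μ) ((hEm N).inter hKc.measurableSet)
      rw [compl_inter] at h1
      linarith [measureReal_union_le (μ := μ) (E N)ᶜ Kᶜ]
    refine le_trans (EReal.coe_le_coe_iff.2 ?_) (mul_measureReal_sub_le_measureEntropy hμ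
      (Nat.succ_pos L') hT' hKc.measurableSet (hcov K hKc) inter_subset_right
      (by positivity : (0 : ℝ) < 1 / (N + 1)) ha0 (n₀ := N) (fun x hx => hx.1) hδ)
    exact sub_le_sub_right (mul_le_mul_of_nonneg_left hEK ha0) δ
  refine EReal.ge_of_forall_gt_iff_ge.1 fun z hz => ?_
  have hz' : z < a := EReal.coe_lt_coe_iff.1 hz
  -- This `δ` solves `a * (1 - 2 * δ) - δ = z`.
  refine le_trans (EReal.coe_le_coe_iff.2 ?_)
    (key ((a - z) / (2 * a + 1)) (div_pos (sub_pos.2 hz') (by positivity)))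
  have : (a - z) / (2 * a + 1) * (2 * a + 1) = a - z := by field_simp
  linarith

end LocEntropy

/-! ### The theorem for Riemannian manifolds -/

theorem theorem2p5 {d : ℕ} {M : Type*} [MetricSpace M] [SecondCountableTopology M]
    [ChartedSpace (EuclideanSpace ℝ (Fin d)) M] [IsManifold (𝓡 d) ∞ M]
    [RiemannianBundle (fun x : M => TangentSpace (𝓡 d) x)]
    [IsContMDiffRiemannianBundle (𝓡 d) ∞ (EuclideanSpace ℝ (Fin d))
      (fun x : M => TangentSpace (𝓡 d) x)]
    [IsRiemannianManifold (𝓡 d) M] [CompleteSpace M]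
    [MeasurableSpace M] [BorelSpace M]
    (μ : Measure M) [IsProbabilityMeasure μ]
    (T : M → M) (L : ℝ≥0) (hT : LipschitzWith L T) (hμ : Ergodic T μ) :
    LocEntropy.measureEntropy T μ = LocEntropy.lowerLocalEntropy T μ := by
  -- The comparison of distances in charts needs only continuity of the metric.
  have : IsContinuousRiemannianBundle (EuclideanSpace ℝ (Fin d))
      (fun x : M => TangentSpace (𝓡 d) x) := by
    obtain ⟨g, hg, hgi⟩ := IsContMDiffRiemannianBundle.exists_contMDiff (IB := 𝓡 d) (n := ∞)
      (F := EuclideanSpace ℝ (Fin d)) (E := fun x : M => TangentSpace (𝓡 d) x)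
    exact ⟨g, hg.continuous, hgi⟩
  exact le_antisymm (LocEntropy.measureEntropy_le_lowerLocalEntropy hμ)
    (LocEntropy.lowerLocalEntropy_le_measureEntropy hμ.toMeasurePreserving hT
      fun K hK => hK.hasPolynomialCover (d := d))
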